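/- Let $1\le r<s$ be integers. In the semi-random hypergraph process on $[n]=\{1,\dots,n\}$ ($n\ge s$), one starts from the empty hypergraph; in each round $t\ge1$ a set $U_t$ of $r$ vertices is chosen uniformly at random from $[n]$, independently of the past, the player replies with a set $V_t\subseteq[n]$ of $s-r$ vertices, and the edge $U_t\cup V_t$ is added (parallel edges are allowed, and $U_t,V_t$ may overlap, in which case the edge is a multiset). A strategy $\mathcal S$ specifies, for each $n$ and $t$, a probability distribution for $V_t$ depending on $U_1,V_1,\dots,U_{t-1},V_{t-1},U_t$. Let $H_t^{(r,s)}$ be the resulting multihypergraph after $t$ rounds. For a fixed $s$-graph $G$ (an $s$-uniform hypergraph without repeated edges) let $\mathcal P_G$ be the property of containing a sub-hypergraph isomorphic to $G$. For $0<q<1$ let $\tau^{(r)}_{\mathcal P_G}(q,n)\in\mathbb N\cup\{\infty\}$ be the infimum, over all strategies on $[n]$, of the least $t\ge 0$ with $\mathbb P[H_t^{(r,s)}\in\mathcal P_G]\ge q$ ($\infty$ if there is no such $t$), and let $$\tau^{(r)}_{\mathcal P_G}=\lim_{q\to1^-}\limsup_{n\to\infty}\frac{\ln \tau^{(r)}_{\mathcal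 P_G}(q,n)}{\ln n}.$$ For $1\le c\le s\le k$, an $(s,c)$-starplus of excess $\ell$ on $k$ vertices is a $k$-vertex $s$-graph whose edges are all $\binom{k-c}{s-c}$ $s$-sets of vertices containing a fixed set $C$ of $c$ vertices, together with $\ell$ further $s$-sets. Theorem. Let $r\ge2$ and $s>r$, and let $G$ be an $(s,s-r)$-starplus on $k\ge s$ vertices with excess $$\ell\le\frac{r\binom{k-s+r}{r}-(k-s+r)}{k-s}$$ (if $k=s$, then $G$ is a single edge, $\ell=0$, and this condition is regarded as satisfied). Put $$\kappa=r-\frac{k-s+r}{\binom{k-s+r}{r}+\ell}.$$ Then there exists a strategy $\mathcal S$ such that for every function $\omega=\omega(n)$ tending to infinity as $n\to\infty$, $$\lim_{n\to\infty}\mathbb P\big[H^{(r,s)}_{t}\in\mathcal P_G\big]=1\qquad\text{where } t=\lfloor n^{\kappa}\,\omega\rfloor .$$ Moreover, $\tau^{(r)}_{\mathcal P_G}=\kappa$, that is, the limit defining $\tau^{(r)}_{\mathcal P_G}$ exists and equals $\kappa$. -/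

import Mathlib

open Filter Topology
open scoped ENNReal

noncomputable section

/-! ### Uniform hypergraphs and starpluses -/

/-- An `s`-uniform hypergraph (`s`-graph) on the vertex set `V`, without repeated edges. -/
structure UniformHypergraph (V : Type*) (s : ℕ) where
  /-- the set of edges -/
  edges : Finset (Finset V)
  /-- every edge has exactly `s` vertices -/
  card_eq : ∀ e ∈ edges, e.card = s

namespace UniformHypergraph

/-- The edge set of the full star with center `C`: all `s`-sets of vertices containing `C`. -/
def fullStar (V : Type*) [Fintype V] [DecidableEq V] (s : ℕ) (C : Finset V) :
    Finset (Finset V) :=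
  (Finset.powersetCard s Finset.univ).filter (fun e => C ⊆ e)

/-- `G` is an `(s, c)`-starplus of excess `l`, where `1 ≤ c ≤ s ≤ |V|`: its edge set is that of a
full `c`-star together with `l` further edges. -/
def IsStarplus {V : Type*} [Fintype V] [DecidableEq V] {s : ℕ} (G : UniformHypergraph V s)
    (c l : ℕ) : Prop :=
  1 ≤ c ∧ c ≤ s ∧ s ≤ Fintype.card V ∧
    ∃ (C : Finset V) (A : Finset (Finset V)),
      C.card = c ∧ A.card = l ∧ Disjoint (fullStar V s C) A ∧ G.edges = fullStar V s C ∪ A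

end UniformHypergraph

/-! ### The semi-random hypergraph process -/

namespace SemiRandom

/-- The `m`-element subsets of `[n]`. (If `n < m` there are none; then the whole set `[n]` is used,
only so that the process is defined for every `n`. This concerns finitely many `n` and has no
influence on limits as `n → ∞`.) -/
abbrev Subsets (n m : ℕ) : Type := {A : Finset (Fin n) // A.card = min m n}

instance (n m : ℕ) : Nonempty (Subsets n m) := by
  obtain ⟨A, -, hA⟩ := Finset.exists_subset_card_eq
    (s := (Finset.univ : Finset (Fin n))) (n := min m n) (by simp)
  exact ⟨⟨A, hA⟩⟩

/-- The history of the process: the list of pairs `(U_i, V_i)` of the rounds played so far, the most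
recent round first. -/
abbrev History (r s n : ℕ) : Type := List (Subsets n r × Subsets n (s - r))

/-- A strategy on `[n]`: for every history `(U_1, V_1), …, (U_{t-1}, V_{t-1})` (its length
determines the number `t` of the current round) and every random `r`-set `U_t`, a probability
distribution on the `(s - r)`-sets, from which `V_t` is drawn. -/
abbrev Strategy (r s n : ℕ) : Type :=
  History r s n → Subsets n r → PMF (Subsets n (s - r))

/-- The law of the history after `t` rounds: in every round `U` is a uniformly random `r`-subset of
`[n]`, independent of the past, and then `V` is drawn according to the strategy. -/
def law {r s n : ℕ} (S : Strategy r s n) : ℕ → PMF (History r s n)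
  | 0 => PMF.pure []
  | t + 1 =>
    (law S t).bind fun h =>
      (PMF.uniformOfFintype (Subsets n r)).bind fun u =>
        (S h u).bind fun v => PMF.pure ((u, v) :: h)

/-- Multihypergraphs on `[n]`: multisets of edges. Edges are themselves multisets of vertices,
since `U` and `V` may overlap. -/
abbrev MultiHypergraph (n : ℕ) : Type := Multiset (Multiset (Fin n))

/-- The multihypergraph built by a history: its edges are the unions, as multisets, of `U_i` and
`V_i`. -/
def hypergraph {r s n : ℕ} (h : History r s n) : MultiHypergraph n :=
  Multiset.ofList (h.map fun p => p.1.1.val + p.2.1.val)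

/-- A property of multihypergraphs on the vertex sets `[n]`. -/
abbrev HypergraphProperty : Type := (n : ℕ) → Set (MultiHypergraph n)

/-- The property of containing a sub-hypergraph isomorphic to `G`. -/
def containsCopy {V : Type*} {s : ℕ} (G : UniformHypergraph V s) : HypergraphProperty :=
  fun n => {H | ∃ φ : V ↪ Fin n, ∀ e ∈ G.edges, (e.map φ).val ∈ H}

/-- The probability that the multihypergraph built in `t` rounds by the strategy `S` has the
property `P`. -/
def prob {r s n : ℕ} (S : Strategy r s n) (P : HypergraphProperty) (t : ℕ) : ℝ≥0∞ :=
  (law S t).toOuterMeasure {h | hypergraph h ∈ P n}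

/-- The least `t` such that the property holds after `t` rounds with probability at least `q`
(`⊤` if there is no such `t`). -/
def strategyTime {r s n : ℕ} (S : Strategy r s n) (P : HypergraphProperty) (q : ℝ) : ℕ∞ :=
  ⨅ (t : ℕ) (_ : ENNReal.ofReal q ≤ prob S P t), (t : ℕ∞)

/-- The infimum of `strategyTime` over all strategies on `[n]`. -/
def optimalTime (r s : ℕ) (P : HypergraphProperty) (q : ℝ) (n : ℕ) : ℕ∞ :=
  ⨅ S : Strategy r s n, strategyTime S P q

/-- `limsup` of `ln (optimalTime) / ln n` as `n → ∞`, in the extended reals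
(`ln 0 = -∞`, `ln ∞ = ∞`). -/
def exponentAt (r s : ℕ) (P : HypergraphProperty) (q : ℝ) : EReal :=
  limsup (fun n : ℕ =>
    ENNReal.log ((optimalTime r s P q n : ℕ∞) : ℝ≥0∞) / ((Real.log (n : ℝ) : ℝ) : EReal)) atTop

/-- The threshold exponent of the property `P`, that is the limit of `exponentAt` as `q → 1⁻`,
exists and equals `x`. -/
def HasThresholdExponent (r s : ℕ) (P : HypergraphProperty) (x : EReal) : Prop :=
  Tendsto (exponentAt r s P) (𝓝[<] (1 : ℝ)) (𝓝 x)

end SemiRandom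

end

/-! Write `m = k - s + r` for the number of vertices outside the center and `e` for the number of
edges, so that κ = r - m/e.

Lower bound, for every strategy. Expose a copy of `G` from its earliest round. That round fixes `s`
of its vertices, the other `k - s` are guessed, and each of the remaining `e - 1` edges needs a
later random set inside the `k`-set now fixed, which has probability O(n^(-r)) whatever the player
does. The expected number of such configurations is O(t^e n^(m - re)) = O((t / n^κ)^e), so success
with probability 1/2 forces t ≥ c n^κ (`prob_containsCopy_le`, `exists_forall_prob_half_le`).

Upper bound. Give every vertex of `G` its own class of N = Θ(n) vertices and fix the image of the
center; N^m potential copies remain, indexed by tuples `x`. Play `e` blocks of t ≈ n^κ rounds, one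
per edge, star edges first. In block `i` the copy `x` needs its target, the image of an `r`-set `R
i` outside the center, to be drawn. This has probability q ≈ n^(-m/e), so N^m q^e has constant
order. In star blocks the player answers with the center and commits to no copy. Later, the player
must recognize which copy to extend. This is unambiguous if `x` is isolated (`IsIsolatedHit`): no
other tuple agreeing with `x` in at least `r` places has its whole star hit. Isolation also demands
that no other tuple has all targets hit, so the events for different `x` are disjoint and their
probabilities add.

Isolation is where the excess enters. The N^(m-j) or fewer tuples agreeing with `x` exactly on a
given `j`-set, j ≥ r, each need at least C(m,r) - C(j,r) further star targets, so the union bound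
needs e(m - j) ≤ m(C(m,r) - C(j,r)). At j = r this is the bound on the excess; larger j follow by
convexity (`Nat.mul_sub_choose_le`). Hence success has probability bounded below
(`prob_respond_ge`), and independent repetitions bring it arbitrarily close to 1 in O(n^κ) rounds
(`prob_repeatStrategy_ge`). -/

noncomputable section

/-! ### Expectations with respect to a probability mass function -/

namespace PMF

/-- The expectation of a nonnegative function. -/
def expect {α : Type*} (p : PMF α) (f : α → ℝ≥0∞) : ℝ≥0∞ := ∑' a, p a * f a

variable {α β : Type*}

theorem expect_pure (a : α) (f : α → ℝ≥0∞) : (PMF.pure a).expect f = f a := by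
  unfold expect
  rw [tsum_eq_single a]
  · simp
  · intro b hb
    simp [PMF.pure_apply, hb]

theorem expect_bind (p : PMF α) (k : α → PMF β) (f : β → ℝ≥0∞) :
    (p.bind k).expect f = p.expect fun a => (k a).expect f := by
  unfold expect
  simp_rw [PMF.bind_apply, ← ENNReal.tsum_mul_right, ← ENNReal.tsum_mul_left]
  rw [ENNReal.tsum_comm]
  simp_rw [mul_assoc]

theorem expect_mono (p : PMF α) {f g : α → ℝ≥0∞} (h : ∀ a, f a ≤ g a) :
    p.expect f ≤ p.expect g :=
  ENNReal.tsum_le_tsum fun a => mul_le_mul_right (h a) _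

theorem expect_congr_support (p : PMF α) {f g : α → ℝ≥0∞} (h : ∀ a ∈ p.support, f a = g a) :
    p.expect f = p.expect g := by
  refine tsum_congr fun a => ?_
  by_cases ha : a ∈ p.support
  · rw [h a ha]
  · rw [PMF.mem_support_iff, not_not] at ha
    simp [ha]

theorem expect_const (p : PMF α) (c : ℝ≥0∞) : p.expect (fun _ => c) = c := by
  unfold expect
  rw [ENNReal.tsum_mul_right, PMF.tsum_coe, one_mul]

theorem expect_add (p : PMF α) (f g : α → ℝ≥0∞) :
    p.expect (fun a => f a + g a) = p.expect f + p.expect g := by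
  unfold expect
  simp_rw [mul_add]
  exact ENNReal.tsum_add

theorem expect_const_mul (p : PMF α) (c : ℝ≥0∞) (f : α → ℝ≥0∞) :
    p.expect (fun a => c * f a) = c * p.expect f := by
  unfold expect
  rw [← ENNReal.tsum_mul_left]
  exact tsum_congr fun a => by ring

theorem toOuterMeasure_eq_expect (p : PMF α) (s : Set α) :
    p.toOuterMeasure s = p.expect (s.indicator 1) := by
  rw [PMF.toOuterMeasure_apply]
  refine tsum_congr fun a => ?_
  by_cases h : a ∈ s <;> simp [h]

theorem expect_uniformOfFintype [Fintype α] [Nonempty α] (f : α → ℝ≥0∞) :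
    (PMF.uniformOfFintype α).expect f = (Fintype.card α : ℝ≥0∞)⁻¹ * ∑ a, f a := by
  unfold expect
  simp [Finset.mul_sum, tsum_fintype]

end PMF

namespace SemiRandom

variable {r s n : ℕ}

theorem expect_law_succ (S : Strategy r s n) (t : ℕ) (f : History r s n → ℝ≥0∞) :
    (law S (t + 1)).expect f =
      (law S t).expect fun h => (PMF.uniformOfFintype (Subsets n r)).expect fun u =>
        (S h u).expect fun v => f ((u, v) :: h) := by
  simp only [law, PMF.expect_bind, PMF.expect_pure]

theorem prob_eq_expect (S : Strategy r s n) (P : HypergraphProperty) (t : ℕ) :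
    prob S P t = (law S t).expect ({h | hypergraph h ∈ P n}.indicator 1) :=
  PMF.toOuterMeasure_eq_expect _ _

/-! ### The first moment bound, for all strategies -/

/-- The union of both parts of a round, and a further set. -/
def roundSpan (p : Subsets n r × Subsets n (s - r)) (D : Finset (Fin n)) : Finset (Fin n) :=
  p.1.1 ∪ p.2.1 ∪ D

/-- For every round and every set `D` of `d` vertices: the span of the round and `D`, with the number
of later rounds whose random set is contained in it. -/
def tracked (d : ℕ) : History r s n → List (Finset (Fin n) × ℕ)
  | [] => []
  | p :: h =>
    ((Finset.univ.powersetCard d).toList.map fun D => (roundSpan p D, 0)) ++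
      (tracked d h).map fun q => (q.1, if p.1.1 ⊆ q.1 then q.2 + 1 else q.2)

/-- The number of choices of a tracked set and of `j` later rounds with random set inside. -/
def trackedCount (d j : ℕ) (h : History r s n) : ℝ≥0∞ :=
  ((tracked d h).map fun q => (q.2.choose j : ℝ≥0∞)).sum

theorem card_roundSpan_le (hrs : r ≤ s) (p : Subsets n r × Subsets n (s - r))
    (D : Finset (Fin n)) : (roundSpan p D).card ≤ s + D.card := by
  have h1 := Finset.card_union_le (p.1.1 ∪ p.2.1) D
  have h2 := Finset.card_union_le p.1.1 p.2.1
  have h3 := p.1.2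
  have h4 := p.2.2
  unfold roundSpan
  have := min_le_left r n
  have := min_le_left (s - r) n
  omega

theorem card_le_of_mem_tracked (hrs : r ≤ s) (d : ℕ) (h : History r s n) :
    ∀ q ∈ tracked d h, q.1.card ≤ s + d := by
  induction h with
  | nil => simp [tracked]
  | cons p h ih =>
    intro q hq
    rw [tracked, List.mem_append, List.mem_map, List.mem_map] at hq
    rcases hq with ⟨D, hD, rfl⟩ | ⟨q', hq', rfl⟩
    · rw [Finset.mem_toList, Finset.mem_powersetCard] at hD
      rw [← hD.2]
      exact card_roundSpan_le hrs p D
    · exact ih q' hq'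

theorem trackedCount_zero_cons (d : ℕ) (p : Subsets n r × Subsets n (s - r))
    (h : History r s n) :
    trackedCount d 0 (p :: h) = n.choose d + trackedCount d 0 h := by
  simp [trackedCount, tracked, Function.comp_def]

/-- Pascal's rule for the sets hit by the new round; the sets created by that round have counter
zero and contribute nothing. -/
theorem trackedCount_succ_cons (d j : ℕ) (p : Subsets n r × Subsets n (s - r))
    (h : History r s n) :
    trackedCount d (j + 1) (p :: h) = trackedCount d (j + 1) h +
      ((tracked d h).map fun q => if p.1.1 ⊆ q.1 then (q.2.choose j : ℝ≥0∞) else 0).sum := by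
  simp only [trackedCount, tracked, List.map_append, List.map_map, List.sum_append,
    Function.comp_def, ← List.sum_map_add]
  have h0 : ((Finset.univ.powersetCard d : Finset (Finset (Fin n))).toList.map
      fun _ => ((Nat.choose 0 (j + 1) : ℕ) : ℝ≥0∞)).sum = 0 := by simp
  rw [h0, zero_add]
  congr 1
  refine List.map_congr_left fun q _ => ?_
  split_ifs
  · rw [Nat.choose_succ_succ]; push_cast; ring
  · simp

theorem card_subsets (n r : ℕ) (h : r ≤ n) : Fintype.card (Subsets n r) = n.choose r := by
  rw [Fintype.card_subtype]
  have : (Finset.univ.filter fun A : Finset (Fin n) => A.card = min r n)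
      = Finset.univ.powersetCard r := by
    ext A
    simp [Finset.mem_powersetCard, min_eq_left h]
  rw [this]
  simp

theorem card_subsets_subset_le (hn : r ≤ n) (S : Finset (Fin n)) {k : ℕ} (hS : S.card ≤ k) :
    (Finset.univ.filter fun u : Subsets n r => u.1 ⊆ S).card ≤ k.choose r := by
  calc (Finset.univ.filter fun u : Subsets n r => u.1 ⊆ S).card
      ≤ (S.powersetCard r).card := by
        refine Finset.card_le_card_of_injOn Subtype.val ?_ Subtype.val_injective.injOn
        intro u hu
        simp only [Finset.coe_filter, Finset.mem_univ, true_and, Set.mem_ofPred_eq] at hu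
        simp only [Finset.mem_coe, Finset.mem_powersetCard]
        exact ⟨hu, by rw [u.2, min_eq_left hn]⟩
    _ ≤ k.choose r := by
        rw [Finset.card_powersetCard]
        exact Nat.choose_le_choose r hS

/-- The upper bound for the probability that a random `r`-set lies in a given set of `k` vertices. -/
def hitBound (n r k : ℕ) : ℝ≥0∞ := (n.choose r : ℝ≥0∞)⁻¹ * k.choose r

/-- The sets in `L` are fixed before `u` is drawn, so each is hit with probability at most
`hitBound`, independently of its counter. -/
theorem expect_sum_ite_le (hn : r ≤ n) {k : ℕ} (L : List (Finset (Fin n) × ℕ))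
    (hL : ∀ q ∈ L, q.1.card ≤ k) (j : ℕ) :
    ((PMF.uniformOfFintype (Subsets n r)).expect fun u =>
      (L.map fun q => if u.1 ⊆ q.1 then (q.2.choose j : ℝ≥0∞) else 0).sum)
      ≤ hitBound n r k * (L.map fun q => (q.2.choose j : ℝ≥0∞)).sum := by
  induction L with
  | nil => simp [PMF.expect_const]
  | cons q L ih =>
    simp only [List.map_cons, List.sum_cons, PMF.expect_add, mul_add]
    refine add_le_add ?_ (ih fun q hq => hL q (List.mem_cons_of_mem _ hq))
    rw [PMF.expect_uniformOfFintype, ← Finset.sum_filter, Finset.sum_const, nsmul_eq_mul,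
      card_subsets n r hn, hitBound, mul_assoc]
    gcongr
    exact card_subsets_subset_le hn _ (hL q List.mem_cons_self)

theorem expect_trackedCount_le (hrs : r ≤ s) (hn : r ≤ n) (S : Strategy r s n) (d j t : ℕ) :
    (law S t).expect (trackedCount d j) ≤
      hitBound n r (s + d) ^ j * (t : ℝ≥0∞) ^ (j + 1) * n.choose d := by
  induction t generalizing j with
  | zero => simp [law, PMF.expect_pure, trackedCount, tracked]
  | succ t ih =>
    rw [expect_law_succ]
    cases j with
    | zero =>
      simp only [trackedCount_zero_cons, PMF.expect_const, PMF.expect_add]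
      calc _ ≤ (n.choose d : ℝ≥0∞) + _ := add_le_add le_rfl (ih 0)
        _ = _ := by push_cast; ring
    | succ j =>
      simp only [trackedCount_succ_cons, PMF.expect_const, PMF.expect_add]
      calc _ ≤ (law S t).expect (trackedCount d (j + 1)) +
            (law S t).expect (fun h => hitBound n r (s + d) * trackedCount d j h) := by
              gcongr
              refine PMF.expect_mono _ fun h => ?_
              exact (PMF.expect_mono _ fun u => (PMF.expect_const (S h u) _).le).trans
                (expect_sum_ite_le hn _ (card_le_of_mem_tracked hrs d h) j)
        _ ≤ hitBound n r (s + d) ^ (j + 1) * (t : ℝ≥0∞) ^ (j + 1 + 1) * n.choose d +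
            hitBound n r (s + d) *
              (hitBound n r (s + d) ^ j * (t : ℝ≥0∞) ^ (j + 1) * n.choose d) := by
              rw [PMF.expect_const_mul]
              gcongr
              · exact ih (j + 1)
              · exact ih j
        _ = hitBound n r (s + d) ^ (j + 1) * (n.choose d) *
              ((t : ℝ≥0∞) ^ (j + 1) * (t + 1)) := by ring
        _ ≤ hitBound n r (s + d) ^ (j + 1) * (n.choose d) *
              (((t : ℝ≥0∞) + 1) ^ (j + 1) * (t + 1)) := by
              gcongr
              exact le_self_add
        _ = _ := by push_cast; ring

theorem one_le_trackedCount (d j : ℕ) (g : History r s n)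
    (p : Subsets n r × Subsets n (s - r)) (h : History r s n) (D : Finset (Fin n))
    (hD : D.card = d) (hj : j ≤ g.countP fun q => q.1.1 ⊆ roundSpan p D) :
    1 ≤ trackedCount d j (g ++ p :: h) := by
  have key : (roundSpan p D, g.countP fun q => q.1.1 ⊆ roundSpan p D)
      ∈ tracked d (g ++ p :: h) := by
    clear hj
    induction g with
    | nil =>
      simp only [List.nil_append, tracked, List.countP_nil, List.mem_append]
      left
      simp only [List.mem_map]
      exact ⟨D, by simp [hD], rfl⟩
    | cons q g ih =>
      rw [List.cons_append, tracked, List.mem_append]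
      right
      rw [List.mem_map]
      refine ⟨_, ih, ?_⟩
      simp only [List.countP_cons, decide_eq_true_eq]
      split_ifs <;> rfl
  have h1 : ((g.countP fun q => q.1.1 ⊆ roundSpan p D).choose j : ℝ≥0∞)
      ≤ trackedCount d j (g ++ p :: h) :=
    List.single_le_sum (fun _ _ => bot_le) _ (List.mem_map_of_mem
      (f := fun q : Finset (Fin n) × ℕ => (q.2.choose j : ℝ≥0∞)) key)
  refine le_trans ?_ h1
  exact_mod_cast Nat.choose_pos hj

end SemiRandom
end

/-! ### From copies of the hypergraph to the lower bound on the time -/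

noncomputable section
namespace SemiRandom

variable {r s n : ℕ}

theorem mem_hypergraph {h : History r s n} {E : Multiset (Fin n)} :
    E ∈ hypergraph h ↔ ∃ p ∈ h, p.1.1.val + p.2.1.val = E := by
  simp [hypergraph]

/-- Histories list the latest round first, so for them `a` is the earliest round with property `Q`.
-/
theorem _root_.List.exists_append_cons_of_exists {α : Type*} (Q : α → Prop) (l : List α)
    (h : ∃ a ∈ l, Q a) : ∃ g a l', l = g ++ a :: l' ∧ Q a ∧ ∀ b ∈ l', ¬ Q b := by
  induction l with
  | nil => simp at h
  | cons a l ih =>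
    by_cases hl : ∃ b ∈ l, Q b
    · obtain ⟨g, b, l', rfl, hb, hl'⟩ := ih hl
      exact ⟨a :: g, b, l', rfl, hb, hl'⟩
    · push Not at hl
      obtain ⟨b, hb, hQ⟩ := h
      rcases List.mem_cons.1 hb with rfl | hb
      · exact ⟨[], b, l, rfl, hQ, hl⟩
      · exact absurd hQ (hl b hb)

/-- Take the earliest round giving an edge of the copy, and let `D` be the image of the vertices off
that edge. The tracked set is then the vertex set of the copy, and every other edge of the copy
comes from a later round inside it. -/
theorem one_le_trackedCount_of_containsCopy {V : Type*} [Fintype V] [DecidableEq V]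
    (G : UniformHypergraph V s) (hG : G.edges.Nonempty) (h : History r s n)
    (hh : hypergraph h ∈ containsCopy G n) :
    1 ≤ trackedCount (Fintype.card V - s) (G.edges.card - 1) h := by
  obtain ⟨φ, hφ⟩ := hh
  simp only [mem_hypergraph] at hφ
  obtain ⟨g, p, h', rfl, ⟨f, hf, hpf⟩, hlast⟩ := List.exists_append_cons_of_exists
    (fun p : Subsets n r × Subsets n (s - r) =>
      ∃ f ∈ G.edges, p.1.1.val + p.2.1.val = (f.map φ).val) h
    (by
      obtain ⟨f, hf⟩ := hG
      obtain ⟨p, hp, hpf⟩ := hφ f hf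
      exact ⟨p, hp, f, hf, hpf⟩)
  have hspan : ∀ q : Subsets n r × Subsets n (s - r), ∀ e : Finset V,
      q.1.1.val + q.2.1.val = (e.map φ).val → q.1.1 ∪ q.2.1 = e.map φ := by
    intro q e he
    ext a
    rw [Finset.mem_union, ← Finset.mem_val, ← Finset.mem_val, ← Multiset.mem_add, he,
      Finset.mem_val]
  have hS : roundSpan p ((Finset.univ \ f).map φ) = Finset.univ.map φ := by
    rw [roundSpan, hspan p f hpf, ← Finset.map_union]
    simp
  refine one_le_trackedCount _ _ g p h' ((Finset.univ \ f).map φ) ?_ ?_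
  · rw [Finset.card_map, Finset.card_sdiff_of_subset (Finset.subset_univ _), G.card_eq f hf,
      Finset.card_univ]
  rw [hS]
  have hg : ∀ e ∈ G.edges.erase f, ∃ q ∈ g, q.1.1.val + q.2.1.val = (e.map φ).val := by
    intro e he
    rw [Finset.mem_erase] at he
    obtain ⟨q, hq, hqe⟩ := hφ e he.2
    rw [List.mem_append, List.mem_cons] at hq
    rcases hq with hq | rfl | hq
    · exact ⟨q, hq, hqe⟩
    · exact absurd (Finset.map_injective φ (Finset.val_injective (hqe.symm.trans hpf))) he.1
    · exact absurd ⟨e, he.2, hqe⟩ (hlast q hq)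
  choose! ψ hψ hψe using hg
  rw [← Finset.card_erase_of_mem hf, List.countP_eq_length_filter]
  refine le_trans (Finset.card_le_card_of_injOn (t := (g.filter
    fun q => q.1.1 ⊆ Finset.univ.map φ).toFinset) ψ ?_ ?_) (List.toFinset_card_le _)
  · intro e he
    simp only [List.coe_toFinset, List.mem_filter, decide_eq_true_eq, Set.mem_ofPred_eq]
    refine ⟨hψ e he, ?_⟩
    calc (ψ e).1.1 ⊆ (ψ e).1.1 ∪ (ψ e).2.1 := Finset.subset_union_left
      _ = e.map φ := hspan _ _ (hψe e he)
      _ ⊆ _ := Finset.map_subset_map.2 (Finset.subset_univ _)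
  -- A round determines its edge and `φ` is injective, so different edges use different rounds.
  · intro e he e' he' hee
    exact Finset.map_injective φ (Finset.val_injective
      ((hψe e he).symm.trans ((congrArg (fun q => q.1.1.val + q.2.1.val) hee).trans
        (hψe e' he'))))

theorem prob_containsCopy_le {V : Type*} [Fintype V] [DecidableEq V]
    (G : UniformHypergraph V s) (hG : G.edges.Nonempty) (hrs : r ≤ s)
    (hs : s ≤ Fintype.card V) (hn : r ≤ n)
    (S : Strategy r s n) (t : ℕ) :
    prob S (containsCopy G) t ≤ hitBound n r (Fintype.card V) ^ (G.edges.card - 1) *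
      (t : ℝ≥0∞) ^ G.edges.card * n.choose (Fintype.card V - s) := by
  have h := expect_trackedCount_le hrs hn S (Fintype.card V - s) (G.edges.card - 1) t
  rw [Nat.add_sub_cancel' hs, Nat.sub_add_cancel (Finset.card_pos.2 hG)] at h
  refine le_trans ?_ h
  rw [prob_eq_expect]
  refine PMF.expect_mono _ fun g => ?_
  by_cases hg : hypergraph g ∈ containsCopy G n
  · rw [Set.indicator_of_mem (by exact hg)]
    exact one_le_trackedCount_of_containsCopy G hG g hg
  · rw [Set.indicator_of_notMem (by exact hg)]
    exact bot_le

theorem pow_le_mul_choose {r n : ℕ} (hn : 2 * r ≤ n) :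
    (n : ℝ) ^ r ≤ (2 : ℝ) ^ r * (r.factorial : ℝ) * (n.choose r : ℝ) := by
  have h1 := Nat.pow_le_choose (α := ℝ) r n
  rw [div_le_iff₀ (by positivity)] at h1
  have h2 : (n : ℝ) / 2 ≤ ((n + 1 - r : ℕ) : ℝ) := by
    rw [div_le_iff₀ (by norm_num)]
    exact_mod_cast (by omega : n ≤ (n + 1 - r) * 2)
  calc (n : ℝ) ^ r = 2 ^ r * ((n : ℝ) / 2) ^ r := by
        rw [← mul_pow]; congr 1; ring
    _ ≤ 2 ^ r * (((n + 1 - r : ℕ) : ℝ) ^ r) := by gcongr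
    _ ≤ 2 ^ r * ((n.choose r : ℝ) * (r.factorial : ℝ)) := by
        gcongr
    _ = _ := by ring

/-- If a copy of `G` is present after `t` rounds with probability at least `1 / 2`, then `t` is at
least of the order predicted by the number of edges and vertices. -/
theorem exists_forall_prob_half_le {V : Type*} [Fintype V] [DecidableEq V]
    (G : UniformHypergraph V s) (hG : G.edges.Nonempty) (hrs : r ≤ s)
    (hs : s ≤ Fintype.card V) :
    ∃ c : ℝ, 0 < c ∧ ∀ n : ℕ, 2 * r ≤ n → 0 < n → ∀ (S : Strategy r s n) (t : ℕ),
      ENNReal.ofReal (1 / 2) ≤ prob S (containsCopy G) t →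
      c * (n : ℝ) ^ ((r : ℝ) - ((Fintype.card V : ℝ) - s + r) / G.edges.card) ≤ t := by
  set k := Fintype.card V
  set e := G.edges.card with he
  have hepos : 0 < e := Finset.card_pos.2 hG
  obtain ⟨b, hb⟩ : ∃ b, e = b + 1 := ⟨e - 1, by omega⟩
  set K : ℝ := 2 ^ r * r.factorial * k.choose r with hK
  have hkr : 0 < (k.choose r : ℝ) := by exact_mod_cast Nat.choose_pos (by omega)
  have hKpos : 0 < K := by positivity
  refine ⟨((2 * K ^ b)⁻¹) ^ ((e : ℝ)⁻¹), by positivity, fun n hn hn0 S t hp => ?_⟩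
  have hnpos : (0 : ℝ) < n := by exact_mod_cast hn0
  have hM : (0 : ℝ) < n.choose r := by exact_mod_cast Nat.choose_pos (by omega)
  have h1 := hp.trans (prob_containsCopy_le G hG hrs hs (by omega) S t)
  have h2 : ENNReal.ofReal (1 / 2) ≤ ENNReal.ofReal
      ((((n.choose r : ℝ))⁻¹ * k.choose r) ^ b * (t : ℝ) ^ e * (n.choose (k - s) : ℝ)) := by
    rw [ENNReal.ofReal_mul (by positivity), ENNReal.ofReal_mul (by positivity),
      ENNReal.ofReal_pow (by positivity), ENNReal.ofReal_mul (by positivity),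
      ENNReal.ofReal_inv_of_pos hM, ENNReal.ofReal_pow (by positivity)]
    simp only [ENNReal.ofReal_natCast]
    have : e - 1 = b := by omega
    rw [this] at h1
    exact h1
  rw [ENNReal.ofReal_le_ofReal_iff (by positivity)] at h2
  have h3 : (n.choose r : ℝ)⁻¹ * k.choose r ≤ K * ((n : ℝ) ^ r)⁻¹ := by
    rw [inv_mul_le_iff₀ hM, hK]
    have := pow_le_mul_choose hn
    have hnr : (0 : ℝ) < (n : ℝ) ^ r := by positivity
    rw [← mul_assoc, ← div_eq_mul_inv, le_div_iff₀ hnr]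
    nlinarith
  have h4 : (n.choose (k - s) : ℝ) ≤ (n : ℝ) ^ (k - s) := by
    exact_mod_cast Nat.choose_le_pow n (k - s)
  have h5 : 1 / 2 ≤ (K * ((n : ℝ) ^ r)⁻¹) ^ b * (t : ℝ) ^ e * (n : ℝ) ^ (k - s) :=
    h2.trans (by gcongr)
  have h6 : (2 * K ^ b)⁻¹ * ((n : ℝ) ^ (r * b : ℕ) * ((n : ℝ) ^ (k - s))⁻¹) ≤ (t : ℝ) ^ e := by
    have hA : (0 : ℝ) < (n : ℝ) ^ (r * b) := by positivity
    have hB : (0 : ℝ) < (n : ℝ) ^ (k - s) := by positivity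
    have hC : (0 : ℝ) < K ^ b := by positivity
    rw [mul_pow, inv_pow, ← pow_mul] at h5
    rw [← div_eq_mul_inv, ← div_eq_inv_mul, div_div, div_le_iff₀ (by positivity)]
    have h7 := mul_le_mul_of_nonneg_left h5 hA.le
    have h8 : (n : ℝ) ^ (r * b) * (K ^ b * ((n : ℝ) ^ (r * b))⁻¹ * (t : ℝ) ^ e * (n : ℝ) ^ (k - s))
      = K ^ b * (t : ℝ) ^ e * (n : ℝ) ^ (k - s) := by field_simp
    rw [h8] at h7
    linarith
  have heR : (0 : ℝ) < e := by exact_mod_cast hepos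
  -- As `e = b + 1`, the exponent `r * b - (k - s)` is `e` times the claimed one.
  have h9 : (n : ℝ) ^ (r * b : ℕ) * ((n : ℝ) ^ (k - s))⁻¹
      = ((n : ℝ) ^ ((r : ℝ) - ((k : ℝ) - s + r) / e)) ^ (e : ℝ) := by
    rw [← Real.rpow_mul hnpos.le, ← Real.rpow_natCast, ← Real.rpow_natCast, ← Real.rpow_neg hnpos.le,
      ← Real.rpow_add hnpos]
    congr 1
    rw [sub_mul, div_mul_cancel₀ _ heR.ne', Nat.cast_sub hs, hb]
    push_cast
    ring
  have h10 : (((2 * K ^ b)⁻¹) ^ ((e : ℝ)⁻¹) *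
      (n : ℝ) ^ ((r : ℝ) - ((k : ℝ) - s + r) / e)) ^ e ≤ (t : ℝ) ^ e := by
    have h11 : (((2 * K ^ b)⁻¹) ^ ((e : ℝ)⁻¹)) ^ e = (2 * K ^ b)⁻¹ :=
      Real.rpow_inv_natCast_pow (by positivity) hepos.ne'
    rw [Real.rpow_natCast] at h9
    rw [mul_pow, h11, ← h9]
    exact h6
  exact le_of_pow_le_pow_left₀ hepos.ne' (by positivity) h10

end SemiRandom
end

noncomputable section
namespace SemiRandom

variable {r s n : ℕ}

/-! ### Monotone properties and repeated strategies -/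

theorem containsCopy_mono {V : Type*} (G : UniformHypergraph V s) {H H' : MultiHypergraph n}
    (hle : H ≤ H') (hH : H ∈ containsCopy G n) : H' ∈ containsCopy G n := by
  obtain ⟨φ, hφ⟩ := hH
  exact ⟨φ, fun e he => Multiset.mem_of_le hle (hφ e he)⟩

theorem hypergraph_append (g h : History r s n) :
    hypergraph (g ++ h) = hypergraph g + hypergraph h := by
  simp [hypergraph]

theorem length_of_mem_support_law (S : Strategy r s n) (t : ℕ) (h : History r s n)
    (hh : h ∈ (law S t).support) : h.length = t := by
  induction t generalizing h with
  | zero => simpa [law] using hh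
  | succ t ih =>
    simp only [law, PMF.mem_support_bind_iff, PMF.mem_support_pure_iff] at hh
    obtain ⟨g, hg, u, -, v, -, rfl⟩ := hh
    rw [List.length_cons, ih g hg]

/-- The strategy that plays `S` for `T` rounds, then forgets the past and starts again. -/
def repeatStrategy (S : Strategy r s n) (T : ℕ) : Strategy r s n :=
  fun h u => S (h.take (h.length % T)) u

/-- Rounds before the last multiple of `T` are forgotten, so the latest `j` rounds form a run of `S`
independent of them. -/
theorem expect_law_repeatStrategy (S : Strategy r s n) (T K j : ℕ) (hj : j ≤ T)
    (f : History r s n → ℝ≥0∞) :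
    (law (repeatStrategy S T) (K * T + j)).expect f =
      (law (repeatStrategy S T) (K * T)).expect fun h =>
        (law S j).expect fun g => f (g ++ h) := by
  induction j generalizing f with
  | zero => simp [law, PMF.expect_pure]
  | succ j ih =>
    rw [← add_assoc, expect_law_succ, ih (by omega)]
    refine PMF.expect_congr_support _ fun h hh => ?_
    rw [expect_law_succ]
    refine PMF.expect_congr_support _ fun g hg => ?_
    have hg' := length_of_mem_support_law _ _ _ hg
    have hh' := length_of_mem_support_law _ _ _ hh
    have : repeatStrategy S T (g ++ h) = S g := by
      funext u
      rw [repeatStrategy, List.length_append, hg', hh', Nat.add_mul_mod_self_right,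
        Nat.mod_eq_of_lt (by omega), ← hg', List.take_left]
    rw [this]
    rfl

theorem prob_add_compl (S : Strategy r s n) (P : HypergraphProperty) (t : ℕ) :
    prob S P t + (law S t).expect ({h | hypergraph h ∉ P n}.indicator 1) = 1 := by
  rw [prob_eq_expect, ← PMF.expect_add, ← PMF.expect_const (law S t) 1]
  congr 1
  funext h
  by_cases hh : hypergraph h ∈ P n <;> simp [Set.indicator, hh]

/-- By monotonicity, overall failure requires each of the `K` independent runs to fail. -/
theorem prob_repeatStrategy_ge (S : Strategy r s n) (P : HypergraphProperty)
    (hP : ∀ H H' : MultiHypergraph n, H ≤ H' → H ∈ P n → H' ∈ P n) (T : ℕ) (c : ℝ≥0∞)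
    (hc : c ≤ prob S P T) (K : ℕ) :
    1 - (1 - c) ^ K ≤ prob (repeatStrategy S T) P (K * T) := by
  have hfail : ∀ K : ℕ, (law (repeatStrategy S T) (K * T)).expect
      ({h | hypergraph h ∉ P n}.indicator 1) ≤ (1 - c) ^ K := by
    intro K
    induction K with
    | zero =>
      rw [pow_zero, ← PMF.expect_const (law (repeatStrategy S T) (0 * T)) 1]
      exact PMF.expect_mono _ fun h => Set.indicator_le_self' (by simp) h
    | succ K ih =>
      rw [add_mul, one_mul, expect_law_repeatStrategy S T K T le_rfl, pow_succ']
      refine le_trans ?_ (mul_le_mul_right ih (1 - c))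
      rw [← PMF.expect_const_mul]
      refine PMF.expect_mono _ fun h => ?_
      by_cases hh : hypergraph h ∈ P n
      · rw [Set.indicator_of_notMem (by simpa using hh), mul_zero, nonpos_iff_eq_zero,
          ← PMF.expect_const (law S T) 0]
        congr 1
        funext g
        refine Set.indicator_of_notMem ?_ _
        simp only [Set.mem_ofPred_eq, not_not]
        exact hP _ _ (by rw [hypergraph_append]; exact Multiset.le_add_left _ _) hh
      · rw [Set.indicator_of_mem (by simpa using hh), Pi.one_apply, mul_one]
        have h1 : (law S T).expect (fun g => {h | hypergraph h ∉ P n}.indicator 1 (g ++ h)) ≤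
            (law S T).expect ({h | hypergraph h ∉ P n}.indicator 1) := by
          refine PMF.expect_mono _ fun g => ?_
          by_cases hg : hypergraph g ∈ P n
          · rw [Set.indicator_of_notMem]
            · exact bot_le
            · simp only [Set.mem_ofPred_eq, not_not]
              exact hP _ _ (by rw [hypergraph_append]; exact Multiset.le_add_right _ _) hg
          · rw [Set.indicator_of_mem (a := g) (by simpa using hg)]
            exact Set.indicator_le_self' (by simp) _
        refine h1.trans ?_
        have h2 := prob_add_compl S P T
        have h3 : prob S P T ≠ ⊤ := ne_top_of_le_ne_top ENNReal.one_ne_top (h2 ▸ le_self_add)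
        rw [← h2]
        refine le_trans ?_ (tsub_le_tsub_left hc _)
        rw [ENNReal.add_sub_cancel_left h3]
  refine tsub_le_iff_right.2 ?_
  calc (1 : ℝ≥0∞) = _ := (prob_add_compl (repeatStrategy S T) P (K * T)).symm
    _ ≤ _ := add_le_add le_rfl (hfail K)

theorem prob_mono (S : Strategy r s n) (P : HypergraphProperty)
    (hP : ∀ H H' : MultiHypergraph n, H ≤ H' → H ∈ P n → H' ∈ P n) :
    Monotone (prob S P) := by
  refine monotone_nat_of_le_succ fun t => ?_
  rw [prob_eq_expect, prob_eq_expect, expect_law_succ]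
  refine PMF.expect_mono _ fun h => ?_
  by_cases hh : hypergraph h ∈ P n
  · rw [Set.indicator_of_mem (by exact hh)]
    have : ∀ p, hypergraph (p :: h) ∈ P n := fun p =>
      hP _ _ (by
        rw [← List.singleton_append, hypergraph_append]
        exact Multiset.le_add_left _ _) hh
    simp [this, PMF.expect_const, Set.indicator]
  · rw [Set.indicator_of_notMem (by exact hh)]
    exact bot_le

/-! ### Deterministic strategies -/

/-- The deterministic strategy given by a function of the past random sets (the most recent one
first) and of the present one. -/
def detStrategy (d : List (Subsets n r) → Subsets n r → Subsets n (s - r)) : Strategy r s n :=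
  fun h u => PMF.pure (d (h.map Prod.fst) u)

/-- The history produced by a deterministic strategy. -/
def play (d : List (Subsets n r) → Subsets n r → Subsets n (s - r)) :
    List (Subsets n r) → History r s n
  | [] => []
  | u :: us => (u, d us u) :: play d us

theorem map_fst_play (d : List (Subsets n r) → Subsets n r → Subsets n (s - r))
    (us : List (Subsets n r)) : (play d us).map Prod.fst = us := by
  induction us with
  | nil => rfl
  | cons u us ih => simp [play, ih]

theorem mem_play (d : List (Subsets n r) → Subsets n r → Subsets n (s - r))
    (us : List (Subsets n r)) (j : ℕ) (hj : j < us.length) :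
    (us[j], d (us.drop (j + 1)) us[j]) ∈ play d us := by
  induction us generalizing j with
  | nil => simp at hj
  | cons u us ih =>
    cases j with
    | zero => simp [play]
    | succ j =>
      simp only [play, List.getElem_cons_succ, List.drop_succ_cons]
      exact List.mem_cons_of_mem _ (ih j (by simpa using hj))

/-- The only randomness is the sequence of random sets, which is uniform; probabilities become
counts of sequences. -/
theorem expect_law_detStrategy (d : List (Subsets n r) → Subsets n r → Subsets n (s - r))
    (t : ℕ) (f : History r s n → ℝ≥0∞) :
    (law (detStrategy d) t).expect f =
      ((Fintype.card (Subsets n r) : ℝ≥0∞) ^ t)⁻¹ *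
        ∑ ω : Fin t → Subsets n r, f (play d (List.ofFn ω)) := by
  induction t generalizing f with
  | zero => simp [law, PMF.expect_pure, play]
  | succ t ih =>
    have h0 : (Fintype.card (Subsets n r) : ℝ≥0∞) ≠ 0 :=
      Nat.cast_ne_zero.2 Fintype.card_ne_zero
    rw [expect_law_succ, ih]
    simp only [detStrategy, PMF.expect_pure, map_fst_play, PMF.expect_uniformOfFintype]
    rw [← Finset.mul_sum, ← mul_assoc, pow_succ,
      ENNReal.mul_inv (Or.inr (ENNReal.natCast_ne_top _)) (Or.inr h0)]
    congr 1
    rw [← Fintype.sum_prod_type' (f := fun (ω : Fin t → Subsets n r) u =>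
      f ((u, d (List.ofFn ω) u) :: play d (List.ofFn ω)))]
    -- The latest round comes first, so the new random set is put at the head of the sequence.
    refine Fintype.sum_equiv ((Equiv.prodComm _ _).trans (Fin.consEquiv fun _ => Subsets n r))
      _ _ fun p => ?_
    simp [Fin.consEquiv, List.ofFn_succ, play]

theorem prob_detStrategy (d : List (Subsets n r) → Subsets n r → Subsets n (s - r))
    (P : HypergraphProperty) (t : ℕ) (A : Finset (Fin t → Subsets n r))
    (hA : ∀ ω ∈ A, hypergraph (play d (List.ofFn ω)) ∈ P n) :
    ((Fintype.card (Subsets n r) : ℝ≥0∞) ^ t)⁻¹ * A.card ≤ prob (detStrategy d) P t := by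
  rw [prob_eq_expect, expect_law_detStrategy]
  gcongr
  rw [Finset.card_eq_sum_ones, Nat.cast_sum]
  refine le_trans (Finset.sum_le_sum fun ω hω => ?_)
    (Finset.sum_le_sum_of_subset (Finset.subset_univ A))
  rw [Set.indicator_of_mem (by exact hA ω hω)]
  simp

end SemiRandom
end

noncomputable section

/-! ### Convexity of binomial coefficients -/

theorem Nat.choose_add_mul_choose_le (i d r : ℕ) :
    i.choose (r + 1) + d * i.choose r ≤ (i + d).choose (r + 1) := by
  induction d with
  | zero => simp
  | succ d ih =>
    have h1 : (i + (d + 1)).choose (r + 1) = (i + d).choose r + (i + d).choose (r + 1) :=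
      Nat.choose_succ_succ _ _
    have h2 : i.choose r ≤ (i + d).choose r := Nat.choose_le_choose r (by omega)
    rw [add_mul]
    omega

theorem Nat.choose_add_le (i d r : ℕ) :
    (i + d).choose (r + 1) ≤ i.choose (r + 1) + d * (i + d).choose r := by
  induction d with
  | zero => simp
  | succ d ih =>
    have h1 : (i + (d + 1)).choose (r + 1) = (i + d).choose r + (i + d).choose (r + 1) :=
      Nat.choose_succ_succ _ _
    have h2 : (i + d).choose r ≤ (i + (d + 1)).choose r := Nat.choose_le_choose r (by omega)
    have h3 := Nat.mul_le_mul_left d h2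
    rw [add_mul]
    omega

/-- The left side is convex in `j`. At `j = r` it is bounded by `h`, and at `j = m` there is
equality. -/
theorem Nat.mul_sub_choose_le {r m e : ℕ} (hr : 1 ≤ r)
    (h : e * (m - r) + m ≤ m * m.choose r) (j : ℕ) (hrj : r ≤ j) (hjm : j < m) :
    e * (m - j) + m * j.choose r ≤ m * m.choose r := by
  obtain ⟨r, rfl⟩ : ∃ r', r = r' + 1 := ⟨r - 1, by omega⟩
  obtain ⟨a, rfl⟩ : ∃ a, j = r + 1 + a := ⟨j - (r + 1), by omega⟩
  obtain ⟨d, rfl⟩ : ∃ d, m = r + 1 + a + d := ⟨m - (r + 1 + a), by omega⟩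
  have h1 := Nat.choose_add_mul_choose_le (r + 1 + a) d r
  have h2 := Nat.choose_add_le (r + 1) a r
  rw [Nat.choose_self] at h2
  have e1 : r + 1 + a + d - (r + 1) = a + d := by omega
  have e2 : r + 1 + a + d - (r + 1 + a) = d := by omega
  rw [e1] at h
  rw [e2]
  set B := (r + 1 + a + d).choose (r + 1)
  set b := (r + 1 + a).choose (r + 1)
  set D := (r + 1 + a).choose r
  set m := r + 1 + a + d
  have hd : 0 < d := by omega
  zify at *
  -- Convexity at `j`: the chord slopes to its left and right, `(b - 1) / a` and `(B - b) / d`, are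
  -- separated by `D`.
  have h3 : (b - 1) * (d : ℤ) ≤ (B - b) * a := by nlinarith
  have h4 : ((a : ℤ) + d) * (e * d + m * b) ≤ (a + d) * (m * B) := by
    have hm : (0 : ℤ) ≤ m := by positivity
    nlinarith [mul_le_mul_of_nonneg_left h3 hm, mul_le_mul_of_nonneg_right h hd.le]
  exact le_of_mul_le_mul_left h4 (by positivity)

/-! ### Hitting targets in blocks of rounds -/

namespace SemiRandom

section Blocks

variable {α : Type*} [Fintype α] [DecidableEq α]

/-- The probability that a given element is among `t` random elements of an `M`-element set. -/
def hitProb (M t : ℕ) : ℝ := 1 - (1 - (M : ℝ)⁻¹) ^ t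

theorem hitProb_nonneg {M : ℕ} (hM : 1 ≤ M) (t : ℕ) : 0 ≤ hitProb M t := by
  have h1 : (M : ℝ)⁻¹ ≤ 1 := inv_le_one_of_one_le₀ (by exact_mod_cast hM)
  have h2 : (0 : ℝ) ≤ (M : ℝ)⁻¹ := by positivity
  have := pow_le_one₀ (n := t) (by linarith : 0 ≤ 1 - (M : ℝ)⁻¹) (by linarith)
  unfold hitProb
  linarith

theorem hitProb_le {M : ℕ} (hM : 1 ≤ M) (t : ℕ) : hitProb M t ≤ t / M := by
  have h1 : (M : ℝ)⁻¹ ≤ 1 := inv_le_one_of_one_le₀ (by exact_mod_cast hM)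
  have h := one_add_mul_le_pow (a := -(M : ℝ)⁻¹) (by linarith) t
  unfold hitProb
  rw [← sub_eq_add_neg] at h
  rw [div_eq_mul_inv]
  linarith

/-- Since (1 - 1/M)(1 + 1/M) ≤ 1, the probability of missing is at most (1 + 1/M)^(-t), and
Bernoulli bounds this by 1/(1 + t/M). -/
theorem div_one_add_le_hitProb {M : ℕ} (hM : 1 ≤ M) (t : ℕ) :
    (t / M : ℝ) / (1 + t / M) ≤ hitProb M t := by
  have h1 : (M : ℝ)⁻¹ ≤ 1 := inv_le_one_of_one_le₀ (by exact_mod_cast hM)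
  have h2 : (0 : ℝ) ≤ (M : ℝ)⁻¹ := by positivity
  have h := one_add_mul_le_pow (a := (M : ℝ)⁻¹) (by linarith) t
  have h3 : (1 - (M : ℝ)⁻¹) ^ t * (1 + (M : ℝ)⁻¹) ^ t ≤ 1 := by
    rw [← mul_pow]
    exact pow_le_one₀ (by nlinarith) (by nlinarith)
  have h4 : (0 : ℝ) ≤ (1 - (M : ℝ)⁻¹) ^ t := pow_nonneg (by linarith) t
  have h5 : (0 : ℝ) ≤ t / M := by positivity
  rw [← div_eq_mul_inv] at h
  rw [div_le_iff₀ (by linarith), hitProb]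
  nlinarith [mul_le_mul_of_nonneg_left h h4]

/-- The sequences that contain `a`. -/
def hitting (t : ℕ) (a : α) : Finset (Fin t → α) :=
  Finset.univ.filter fun ω => ∃ b, ω b = a

theorem mem_hitting {t : ℕ} {a : α} {ω : Fin t → α} : ω ∈ hitting t a ↔ ∃ b, ω b = a := by
  simp [hitting]

theorem compl_hitting (t : ℕ) (a : α) :
    (hitting t a)ᶜ = Fintype.piFinset fun _ : Fin t => ({a}ᶜ : Finset α) := by
  ext ω
  simp [mem_hitting]

theorem card_compl_hitting [Nonempty α] (t : ℕ) (a : α) :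
    ((hitting t a)ᶜ.card : ℝ) =
      (Fintype.card α : ℝ) ^ t * (1 - (Fintype.card α : ℝ)⁻¹) ^ t := by
  have h0 : (Fintype.card α : ℝ) ≠ 0 := Nat.cast_ne_zero.2 Fintype.card_ne_zero
  rw [compl_hitting, Fintype.card_piFinset_const, Finset.card_compl, Finset.card_singleton,
    Nat.cast_pow, Nat.cast_sub Fintype.card_pos, ← mul_pow]
  congr 1
  field_simp
  simp

theorem card_hitting [Nonempty α] (t : ℕ) (a : α) :
    ((hitting t a).card : ℝ) = (Fintype.card α : ℝ) ^ t * hitProb (Fintype.card α) t := by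
  have h1 := card_compl_hitting t a
  have h2 := Finset.card_add_card_compl (hitting t a)
  rw [Fintype.card_fun, Fintype.card_fin] at h2
  have h3 : ((hitting t a).card : ℝ) + ((hitting t a)ᶜ.card : ℝ) = (Fintype.card α : ℝ) ^ t := by
    exact_mod_cast h2
  rw [hitProb]
  linarith

/-- Hitting two given elements is negatively correlated: by inclusion-exclusion this reduces to 1 -
2/M ≤ (1 - 1/M)^2. -/
theorem card_hitting_inter_le [Nonempty α] (t : ℕ) {a b : α} (hab : a ≠ b) :
    ((hitting t a ∩ hitting t b).card : ℝ) ≤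
      (Fintype.card α : ℝ) ^ t * hitProb (Fintype.card α) t ^ 2 := by
  have hM2 : 2 ≤ Fintype.card α := by
    rw [← Finset.card_pair hab]
    exact Finset.card_le_univ _
  have h0 : (Fintype.card α : ℝ) ≠ 0 := Nat.cast_ne_zero.2 Fintype.card_ne_zero
  have hboth : (hitting t a ∪ hitting t b)ᶜ =
      Fintype.piFinset fun _ : Fin t => ({a, b}ᶜ : Finset α) := by
    ext ω
    simp only [Finset.compl_union, compl_hitting, Finset.mem_inter, Fintype.mem_piFinset,
      Finset.mem_compl, Finset.mem_singleton, Finset.mem_insert, not_or, forall_and]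
  have h1 : ((hitting t a ∪ hitting t b)ᶜ.card : ℝ) ≤
      (Fintype.card α : ℝ) ^ t * ((1 - (Fintype.card α : ℝ)⁻¹) ^ t) ^ 2 := by
    rw [hboth, Fintype.card_piFinset_const, Finset.card_compl, Finset.card_pair hab,
      Nat.cast_pow, Nat.cast_sub hM2, ← pow_mul, mul_comm t 2, pow_mul, ← mul_pow]
    refine pow_le_pow_left₀ (sub_nonneg.2 (by exact_mod_cast hM2)) ?_ t
    have : (Fintype.card α : ℝ) * (1 - (Fintype.card α : ℝ)⁻¹) ^ 2 =
        (Fintype.card α : ℝ) - 2 + (Fintype.card α : ℝ)⁻¹ := by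
      field_simp
      ring
    rw [this]
    have : (0 : ℝ) ≤ (Fintype.card α : ℝ)⁻¹ := by positivity
    push_cast
    linarith
  have h2 := Finset.card_add_card_compl (hitting t a ∪ hitting t b)
  rw [Fintype.card_fun, Fintype.card_fin] at h2
  have h3 := Finset.card_union_add_card_inter (hitting t a) (hitting t b)
  have h2' : ((hitting t a ∪ hitting t b).card : ℝ) + ((hitting t a ∪ hitting t b)ᶜ.card : ℝ) =
      (Fintype.card α : ℝ) ^ t := by exact_mod_cast h2
  have h3' : ((hitting t a ∪ hitting t b).card : ℝ) + ((hitting t a ∩ hitting t b).card : ℝ) =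
      (hitting t a).card + (hitting t b).card := by exact_mod_cast h3
  rw [card_hitting, card_hitting] at h3'
  unfold hitProb at *
  nlinarith

variable {W : Type*} [Fintype W] [DecidableEq W] {e t N r : ℕ}

/-- The coordinates in which two tuples agree. -/
def agree (x x' : W → Fin N) : Finset W := Finset.univ.filter fun w => x w = x' w

/-- The blocks that must not all be hit by a tuple agreeing with a hit one exactly on `J`. -/
def forbidden (I : Finset (Fin e)) (r : ℕ) (J : Finset W) : Finset (Fin e) :=
  if r ≤ J.card then I else Finset.univ

/-- All targets of `x` are hit, and no other tuple has all targets hit in the blocks that are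
forbidden by its agreement with `x`. -/
def IsIsolatedHit (tgt : (W → Fin N) → Fin e → α) (I : Finset (Fin e)) (r : ℕ)
    (ω : Fin e → Fin t → α) (x : W → Fin N) : Prop :=
  (∀ i, ω i ∈ hitting t (tgt x i)) ∧
    ∀ x', x' ≠ x → ¬ ∀ i ∈ forbidden I r (agree x x'), ω i ∈ hitting t (tgt x' i)

/-- The sum factorizes over the coordinates, and each factor is 1 + (N - 1)/N ≤ 2. -/
theorem sum_inv_pow_agree_le (hN : 1 ≤ N) (x : W → Fin N) :
    ∑ x' : W → Fin N, (((N : ℝ) ^ (Fintype.card W - (agree x x').card))⁻¹) ≤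
      2 ^ Fintype.card W := by
  have hN0 : (0 : ℝ) < N := by exact_mod_cast hN
  have h1 : ∀ x' : W → Fin N, ((N : ℝ) ^ (Fintype.card W - (agree x x').card))⁻¹ =
      ∏ w, if x w = x' w then (1 : ℝ) else (N : ℝ)⁻¹ := by
    intro x'
    rw [Finset.prod_ite, Finset.prod_const_one, one_mul, Finset.prod_const, inv_pow]
    congr 2
    rw [← Finset.card_compl]
    congr 1
    ext w
    simp [agree]
  simp_rw [h1]
  rw [← Fintype.piFinset_univ, ← Finset.prod_univ_sum (fun _ => Finset.univ)
    (fun w a => if x w = a then (1 : ℝ) else (N : ℝ)⁻¹)]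
  rw [← Finset.card_univ, ← Finset.prod_const]
  refine Finset.prod_le_prod (fun w _ => Finset.sum_nonneg fun a _ => by positivity) fun w _ => ?_
  rw [← Finset.add_sum_erase _ _ (Finset.mem_univ (x w))]
  simp only [if_true]
  have : ∑ a ∈ Finset.univ.erase (x w), (if x w = a then (1 : ℝ) else (N : ℝ)⁻¹) ≤ 1 := by
    calc _ ≤ ∑ a ∈ Finset.univ.erase (x w), (N : ℝ)⁻¹ :=
          Finset.sum_le_sum fun a ha => by rw [if_neg (Finset.ne_of_mem_erase ha).symm]
      _ ≤ ∑ a : Fin N, (N : ℝ)⁻¹ :=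
          Finset.sum_le_sum_of_subset_of_nonneg (Finset.subset_univ _) fun _ _ _ => by positivity
      _ = 1 := by simp [hN0.ne']
  linarith

theorem card_piFinset_hitting [Nonempty α] (a : Fin e → α) :
    ((Fintype.piFinset fun i => hitting t (a i)).card : ℝ) =
      (Fintype.card α : ℝ) ^ (t * e) * hitProb (Fintype.card α) t ^ e := by
  rw [Fintype.card_piFinset, Nat.cast_prod]
  simp only [card_hitting, Finset.prod_const, Finset.card_univ, Fintype.card_fin]
  rw [mul_pow, pow_mul]

/-- Blocks are independent. A block of `F` costs a further factor `hitProb` only where the two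
targets differ; equal targets are hit together. -/
theorem card_filter_hitting_le [Nonempty α] (a a' : Fin e → α) (F : Finset (Fin e)) :
    (((Fintype.piFinset fun i => hitting t (a i)).filter
      fun ω => ∀ i ∈ F, ω i ∈ hitting t (a' i)).card : ℝ) ≤
      (Fintype.card α : ℝ) ^ (t * e) * hitProb (Fintype.card α) t ^ e *
        hitProb (Fintype.card α) t ^ (F.filter fun i => a i ≠ a' i).card := by
  have h1 : (Fintype.piFinset fun i => hitting t (a i)).filter
      (fun ω => ∀ i ∈ F, ω i ∈ hitting t (a' i)) ⊆
      Fintype.piFinset fun i => if i ∈ F.filter (fun i => a i ≠ a' i) then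
        hitting t (a i) ∩ hitting t (a' i) else hitting t (a i) := by
    intro ω hω
    simp only [Finset.mem_filter, Fintype.mem_piFinset] at hω ⊢
    intro i
    split_ifs with hi
    · exact Finset.mem_inter.2 ⟨hω.1 i, hω.2 i hi.1⟩
    · exact hω.1 i
  refine (Nat.cast_le.2 (Finset.card_le_card h1)).trans ?_
  rw [Fintype.card_piFinset, Nat.cast_prod]
  have hq := hitProb_nonneg (M := Fintype.card α) Fintype.card_pos t
  have h2 : ∀ i, (((if i ∈ F.filter (fun i => a i ≠ a' i) then
        hitting t (a i) ∩ hitting t (a' i) else hitting t (a i)).card : ℕ) : ℝ) ≤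
      (Fintype.card α : ℝ) ^ t * hitProb (Fintype.card α) t *
        if i ∈ F.filter (fun i => a i ≠ a' i) then hitProb (Fintype.card α) t else 1 := by
    intro i
    split_ifs with hi
    · refine (card_hitting_inter_le t (Finset.mem_filter.1 hi).2).trans (le_of_eq ?_)
      ring
    · rw [card_hitting, mul_one]
  refine (Finset.prod_le_prod (fun i _ => by positivity) fun i _ => h2 i).trans (le_of_eq ?_)
  rw [Finset.prod_mul_distrib, Finset.prod_const, Finset.card_univ, Fintype.card_fin, mul_pow,
    pow_mul, Finset.prod_ite_mem, Finset.univ_inter, Finset.prod_const]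

/-- Many sequences of blocks hit all targets of an isolated tuple. -/
theorem card_exists_isIsolatedHit_ge [Nonempty α] (tgt : (W → Fin N) → Fin e → α)
    (R : Fin e → Finset W) (htgt : ∀ x x' i, tgt x i = tgt x' i ↔ R i ⊆ agree x x')
    (I : Finset (Fin e)) (r : ℕ) (hN : 1 ≤ N) (η : ℝ) (hη : 0 ≤ η)
    (hq : ∀ J : Finset W, J ≠ Finset.univ →
      hitProb (Fintype.card α) t ^ ((forbidden I r J).filter fun i => ¬ R i ⊆ J).card ≤
        η * ((N : ℝ) ^ (Fintype.card W - J.card))⁻¹)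
    (A : Finset (Fin e → Fin t → α))
    (hA : ∀ ω, ω ∈ A ↔ ∃ x, IsIsolatedHit tgt I r ω x) :
    (Fintype.card α : ℝ) ^ (t * e) * ((N : ℝ) ^ Fintype.card W *
      hitProb (Fintype.card α) t ^ e * (1 - 2 ^ Fintype.card W * η)) ≤ A.card := by
  classical
  set Q : ℝ := (Fintype.card α : ℝ) ^ (t * e) * hitProb (Fintype.card α) t ^ e with hQ
  have hq0 := hitProb_nonneg (M := Fintype.card α) Fintype.card_pos t
  have hQ0 : 0 ≤ Q := by positivity
  let G : (W → Fin N) → Finset (Fin e → Fin t → α) := fun x =>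
    Finset.univ.filter fun ω => IsIsolatedHit tgt I r ω x
  have hG : ∀ x, Q * (1 - 2 ^ Fintype.card W * η) ≤ (G x).card := by
    intro x
    let H := Fintype.piFinset fun i => hitting t (tgt x i)
    let Bad : (W → Fin N) → Finset (Fin e → Fin t → α) := fun x' =>
      H.filter fun ω => ∀ i ∈ forbidden I r (agree x x'), ω i ∈ hitting t (tgt x' i)
    have hsub : H ⊆ G x ∪ (Finset.univ.erase x).biUnion Bad := by
      intro ω hω
      by_cases hg : IsIsolatedHit tgt I r ω x
      · exact Finset.mem_union_left _ (by simpa [G] using hg)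
      · refine Finset.mem_union_right _ ?_
        have hω' : ∀ i, ω i ∈ hitting t (tgt x i) := Fintype.mem_piFinset.1 hω
        rw [IsIsolatedHit] at hg
        push Not at hg
        obtain ⟨x', hx', h⟩ := hg hω'
        simp only [Finset.mem_biUnion]
        exact ⟨x', Finset.mem_erase.2 ⟨hx', Finset.mem_univ _⟩, Finset.mem_filter.2 ⟨hω, h⟩⟩
    have hBad : ∀ x' ∈ Finset.univ.erase x, ((Bad x').card : ℝ) ≤
        Q * η * ((N : ℝ) ^ (Fintype.card W - (agree x x').card))⁻¹ := by
      intro x' hx'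
      have hJ : agree x x' ≠ Finset.univ := by
        intro h
        refine Finset.ne_of_mem_erase hx' (funext fun w => ?_)
        have : w ∈ agree x x' := h ▸ Finset.mem_univ w
        simp only [agree, Finset.mem_filter] at this
        exact this.2.symm
      refine (card_filter_hitting_le _ _ _).trans ?_
      rw [mul_assoc Q]
      refine mul_le_mul_of_nonneg_left ?_ hQ0
      have := hq _ hJ
      simp only [← htgt] at this
      exact this
    have h1 : (H.card : ℝ) ≤ (G x).card + ∑ x' ∈ Finset.univ.erase x, ((Bad x').card : ℝ) := by
      have := (Finset.card_le_card hsub).trans ((Finset.card_union_le _ _).trans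
        (add_le_add le_rfl Finset.card_biUnion_le))
      exact_mod_cast this
    have h2 : ∑ x' ∈ Finset.univ.erase x, ((Bad x').card : ℝ) ≤
        Q * η * 2 ^ Fintype.card W := by
      refine (Finset.sum_le_sum hBad).trans ?_
      rw [← Finset.mul_sum]
      refine mul_le_mul_of_nonneg_left ?_ (by positivity)
      refine le_trans ?_ (sum_inv_pow_agree_le hN x)
      exact Finset.sum_le_sum_of_subset_of_nonneg (Finset.subset_univ _)
        fun _ _ _ => by positivity
    have h3 : (H.card : ℝ) = Q := card_piFinset_hitting _
    nlinarith
  -- Two tuples isolated in the same sequence would both have all targets hit, contradicting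
  -- isolation. So the counts add up and no second moment is needed.
  have hdisj : Set.PairwiseDisjoint (Finset.univ : Finset (W → Fin N)) G := by
    intro x _ x' _ hne
    refine Finset.disjoint_left.2 fun ω hω hω' => ?_
    simp only [G, Finset.mem_filter] at hω hω'
    exact hω.2.2 x' hne.symm fun i _ => hω'.2.1 i
  have hAG : A = Finset.univ.biUnion G := by
    ext ω
    simp [hA, G]
  rw [hAG, Finset.card_biUnion hdisj, Nat.cast_sum]
  refine le_trans (le_of_eq ?_) (Finset.sum_le_sum fun x _ => hG x)
  rw [Finset.sum_const, Finset.card_univ, Fintype.card_fun, Fintype.card_fin, nsmul_eq_mul, hQ]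
  push_cast
  ring

end Blocks
end SemiRandom
end

/-! ### Building plans of a starplus and the player's strategy -/

noncomputable section

namespace UniformHypergraph

variable {V : Type*} [Fintype V] [DecidableEq V]

theorem card_fullStar {s : ℕ} (C : Finset V) (hC : C.card ≤ s) :
    (fullStar V s C).card = (Fintype.card V - C.card).choose (s - C.card) := by
  have h : fullStar V s C = (Cᶜ.powersetCard (s - C.card)).image (C ∪ ·) := by
    ext f
    simp only [fullStar, Finset.mem_filter, Finset.mem_powersetCard, Finset.mem_image,
      Finset.subset_univ, true_and]
    constructor
    · rintro ⟨hf, hCf⟩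
      refine ⟨f \ C, ⟨fun v hv => ?_, ?_⟩, Finset.union_sdiff_of_subset hCf⟩
      · exact Finset.mem_compl.2 (Finset.mem_sdiff.1 hv).2
      · rw [Finset.card_sdiff_of_subset hCf, hf]
    · rintro ⟨R, ⟨hR, hRc⟩, rfl⟩
      refine ⟨?_, Finset.subset_union_left⟩
      rw [Finset.card_union_of_disjoint, hRc, Nat.add_sub_cancel' hC]
      exact Finset.disjoint_left.2 fun v hv hv' => Finset.mem_compl.1 (hR hv') hv
  rw [h, Finset.card_image_of_injOn, Finset.card_powersetCard, Finset.card_compl]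
  intro R hR R' hR' hRR
  have hd : ∀ R ∈ Cᶜ.powersetCard (s - C.card), (C ∪ R) \ C = R := by
    intro R hR
    rw [Finset.union_sdiff_left, Finset.sdiff_eq_self_iff_disjoint]
    exact Finset.disjoint_left.2 fun v hv hv' =>
      Finset.mem_compl.1 ((Finset.mem_powersetCard.1 hR).1 hv) hv'
  rw [← hd R hR, ← hd R' hR']
  exact congrArg (· \ C) hRR

end UniformHypergraph

namespace SemiRandom

/-- An enumeration of the edges of a starplus with center `C`, the star edges at the end, with an
`r`-set of vertices outside `C` chosen in every edge. -/
structure BuildingPlan {V : Type*} [Fintype V] [DecidableEq V] {s : ℕ}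
    (G : UniformHypergraph V s) (r e : ℕ) where
  /-- the center -/
  C : Finset V
  /-- the enumeration of the edges -/
  edge : Fin e → Finset V
  /-- the indices of the star edges -/
  star : Finset (Fin e)
  /-- the sets to be presented to the player -/
  R : Fin e → Finset {v // v ∉ C}
  card_C : C.card = s - r
  mem_edges : ∀ f ∈ G.edges, ∃ i, edge i = f
  card_edge : ∀ i, (edge i).card = s
  card_R : ∀ i, (R i).card = r
  R_subset : ∀ i, (R i).map (Function.Embedding.subtype _) ⊆ edge i
  edge_sdiff : ∀ i ∈ star, edge i \ (R i).map (Function.Embedding.subtype _) = C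
  R_injOn : Set.InjOn R star
  lt_star : ∀ i, i ∉ star → ∀ j ∈ star, i < j
  card_star : star.card = (Fintype.card V - C.card).choose r

/-- The extra edges get the first `l` indices. An edge has at least s - (s - r) = r vertices outside
the center; a star edge has exactly `r`, so there `R` is forced and determines the edge. -/
theorem exists_buildingPlan {V : Type*} [Fintype V] [DecidableEq V] {r s l : ℕ} (hrs : r < s)
    (G : UniformHypergraph V s) (hG : G.IsStarplus (s - r) l) :
    G.edges.card = (Fintype.card V - s + r).choose r + l ∧
      Nonempty (BuildingPlan G r G.edges.card) := by
  obtain ⟨-, -, hsV, C, A, hC, hA, hdisj, hE⟩ := hG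
  have hcard := UniformHypergraph.card_fullStar (s := s) C (by omega)
  have e1 : Fintype.card V - C.card = Fintype.card V - s + r := by omega
  have e2 : s - C.card = r := by omega
  rw [e1, e2] at hcard
  have hecard : G.edges.card = l + (Fintype.card V - s + r).choose r := by
    rw [hE, Finset.card_union_of_disjoint hdisj, hcard, hA, add_comm]
  refine ⟨by omega, ?_⟩
  rw [hecard]
  set B := (Fintype.card V - s + r).choose r with hB
  let g : Fin (l + B) → Finset V := Fin.append (fun i => ((A.equivFinOfCardEq hA).symm i).1)
    (fun i => (((UniformHypergraph.fullStar V s C).equivFinOfCardEq hcard).symm i).1)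
  let I : Finset (Fin (l + B)) := Finset.univ.filter fun i => l ≤ i.1
  have hgA : ∀ i : Fin l, g (Fin.castAdd B i) ∈ A := by
    intro i
    simp only [g, Fin.append_left]
    exact ((A.equivFinOfCardEq hA).symm i).2
  have hgS : ∀ i : Fin B, g (Fin.natAdd l i) ∈ UniformHypergraph.fullStar V s C := by
    intro i
    simp only [g, Fin.append_right]
    exact (((UniformHypergraph.fullStar V s C).equivFinOfCardEq hcard).symm i).2
  have hgE : ∀ i, g i ∈ G.edges := by
    intro i
    rw [hE, Finset.mem_union]
    exact Fin.addCases (fun i => Or.inr (hgA i)) (fun i => Or.inl (hgS i)) i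
  have hgI : ∀ i ∈ I, ∃ i' : Fin B, i = Fin.natAdd l i' := by
    intro i hi
    have hi' : l ≤ i.1 := by simpa [I] using hi
    exact ⟨⟨i.1 - l, by omega⟩, Fin.ext (by simp; omega)⟩
  have hginj : Set.InjOn g I := by
    intro i hi i' hi' h
    obtain ⟨i, rfl⟩ := hgI i hi
    obtain ⟨i', rfl⟩ := hgI i' hi'
    simp only [g, Fin.append_right] at h
    rw [((UniformHypergraph.fullStar V s C).equivFinOfCardEq hcard).symm.injective
      (Subtype.ext h)]
  have hsurj : ∀ f ∈ G.edges, ∃ i, g i = f := by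
    intro f hf
    rw [hE, Finset.mem_union] at hf
    rcases hf with hf | hf
    · exact ⟨Fin.natAdd l (((UniformHypergraph.fullStar V s C).equivFinOfCardEq hcard) ⟨f, hf⟩),
        by simp [g]⟩
    · exact ⟨Fin.castAdd B ((A.equivFinOfCardEq hA) ⟨f, hf⟩), by simp [g]⟩
  have hR : ∀ i, ∃ R : Finset {v // v ∉ C}, R.card = r ∧
      R.map (Function.Embedding.subtype _) ⊆ g i ∧
      (i ∈ I → g i \ R.map (Function.Embedding.subtype _) = C) := by
    intro i
    have hc : r ≤ (g i \ C).card := by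
      have := Finset.le_card_sdiff C (g i)
      rw [G.card_eq _ (hgE i), hC] at this
      omega
    obtain ⟨R₀, hR₀, hR₀c⟩ := Finset.exists_subset_card_eq hc
    have hm : (R₀.subtype (· ∉ C)).map (Function.Embedding.subtype _) = R₀ :=
      Finset.subtype_map_of_mem fun v hv => (Finset.mem_sdiff.1 (hR₀ hv)).2
    refine ⟨R₀.subtype (· ∉ C), ?_, ?_, ?_⟩
    · rw [← Finset.card_map (Function.Embedding.subtype _), hm, hR₀c]
    · rw [hm]
      exact hR₀.trans Finset.sdiff_subset
    · intro hi
      obtain ⟨i', rfl⟩ := hgI i hi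
      have hCg : C ⊆ g (Fin.natAdd l i') := (Finset.mem_filter.1 (hgS i')).2
      have : R₀ = g (Fin.natAdd l i') \ C := by
        refine Finset.eq_of_subset_of_card_le hR₀ ?_
        rw [Finset.card_sdiff_of_subset hCg, G.card_eq _ (hgE _), hC, hR₀c]
        omega
      rw [hm, this, Finset.sdiff_sdiff_eq_self hCg]
  choose R hRc hRs hRC using hR
  refine ⟨{ C := C, edge := g, star := I, R := R, card_C := hC, mem_edges := hsurj,
            card_edge := fun i => G.card_eq _ (hgE i), card_R := hRc, R_subset := hRs,
            edge_sdiff := hRC, R_injOn := ?_, lt_star := ?_, card_star := ?_ }⟩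
  · intro i hi i' hi' h
    refine hginj hi hi' ?_
    rw [← Finset.sdiff_union_of_subset (hRs i), ← Finset.sdiff_union_of_subset (hRs i'),
      hRC i hi, hRC i' hi', h]
  · intro i hi j hj
    simp only [I, Finset.mem_filter, Finset.mem_univ, true_and, not_le] at hi hj
    exact Fin.lt_def.2 (by omega)
  · rw [e1, ← hB]
    have : I = (Finset.univ : Finset (Fin B)).map (Fin.natAddEmb l) := by
      ext i
      simp only [Finset.mem_map, Finset.mem_univ, true_and]
      constructor
      · intro hi
        obtain ⟨i', rfl⟩ := hgI i hi
        exact ⟨i', rfl⟩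
      · rintro ⟨i', rfl⟩
        simp [I]
    rw [this, Finset.card_map, Finset.card_univ, Fintype.card_fin]

namespace BuildingPlan

variable {V : Type*} [Fintype V] [DecidableEq V] {r s e n N t : ℕ} {G : UniformHypergraph V s}
  (p : BuildingPlan G r e) [NeZero N] (ι : V × Fin N ↪ Fin n)

/-- The copy of the vertex set given by a tuple. -/
def copy (x : {v // v ∉ p.C} → Fin N) : V ↪ Fin n where
  toFun v := ι (v, if h : v ∉ p.C then x ⟨v, h⟩ else 0)
  inj' _ _ h := congrArg Prod.fst (ι.injective h)

theorem copy_apply_of_mem (x : {v // v ∉ p.C} → Fin N) {v : V} (hv : v ∈ p.C) :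
    p.copy ι x v = ι (v, 0) := by
  simp [copy, hv]

theorem copy_apply_coe (x : {v // v ∉ p.C} → Fin N) (w : {v // v ∉ p.C}) :
    p.copy ι x w = ι (w, x w) := by
  simp [copy, w.2]

/-- The vertices of the `i`-th edge to be presented to the player. -/
def presented (i : Fin e) : Finset V := (p.R i).map (Function.Embedding.subtype _)

theorem card_presented (i : Fin e) : (p.presented i).card = r := by
  rw [presented, Finset.card_map, p.card_R]

/-- The random set that allows the player to build the `i`-th edge of a copy. -/
def target (x : {v // v ∉ p.C} → Fin N) (i : Fin e) : Subsets n r :=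
  ⟨(p.presented i).map (p.copy ι x), by
    have h : ((p.presented i).map (p.copy ι x)).card = r := by
      rw [Finset.card_map, card_presented]
    have h' := Finset.card_le_univ ((p.presented i).map (p.copy ι x))
    rw [h, Fintype.card_fin] at h'
    rw [h, min_eq_left h']⟩

/-- The answer of the player that builds the `i`-th edge of a copy. -/
def reply (x : {v // v ∉ p.C} → Fin N) (i : Fin e) : Subsets n (s - r) :=
  ⟨(p.edge i \ p.presented i).map (p.copy ι x), by
    have h : ((p.edge i \ p.presented i).map (p.copy ι x)).card = s - r := by
      rw [Finset.card_map, presented, Finset.card_sdiff_of_subset (p.R_subset i), p.card_edge,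
        Finset.card_map, p.card_R]
    have h' := Finset.card_le_univ ((p.edge i \ p.presented i).map (p.copy ι x))
    rw [h, Fintype.card_fin] at h'
    rw [h, min_eq_left h']⟩

theorem target_val_add_reply_val (x : {v // v ∉ p.C} → Fin N) (i : Fin e) :
    (p.target ι x i).1.val + (p.reply ι x i).1.val = ((p.edge i).map (p.copy ι x)).val := by
  have hd : Disjoint (p.target ι x i).1 (p.reply ι x i).1 := by
    simp only [target, reply]
    rw [Finset.disjoint_map]
    exact Finset.disjoint_sdiff
  rw [← Finset.disjUnion_val _ _ hd, Finset.disjUnion_eq_union]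
  simp only [target, reply, presented]
  rw [← Finset.map_union, Finset.union_sdiff_of_subset (p.R_subset i)]

/-- In a star edge the vertices to be supplied are the center, whose image is the same for all
tuples. -/
theorem reply_eq_of_mem_star (x x' : {v // v ∉ p.C} → Fin N) {i : Fin e} (hi : i ∈ p.star) :
    p.reply ι x i = p.reply ι x' i := by
  refine Subtype.ext ?_
  simp only [reply, presented, p.edge_sdiff i hi]
  rw [Finset.map_eq_image, Finset.map_eq_image]
  refine Finset.image_congr fun v hv => ?_
  rw [copy_apply_of_mem _ _ _ hv, copy_apply_of_mem _ _ _ hv]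

/-- Different vertices have disjoint classes, so the image of `R i` reveals the coordinates of the
tuple on `R i`. -/
theorem target_eq_iff (x x' : {v // v ∉ p.C} → Fin N) (i : Fin e) :
    p.target ι x i = p.target ι x' i ↔ p.R i ⊆ agree x x' := by
  constructor
  · intro h w hw
    have h1 : p.copy ι x w ∈ (p.target ι x' i).1 := by
      rw [← h]
      exact Finset.mem_map_of_mem _ (Finset.mem_map_of_mem (Function.Embedding.subtype _) hw)
    obtain ⟨v, hv, hvw⟩ := Finset.mem_map.1 h1
    obtain ⟨w', hw', rfl⟩ := Finset.mem_map.1 hv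
    rw [Function.Embedding.subtype_apply, copy_apply_coe, copy_apply_coe] at hvw
    have h2 := ι.injective hvw
    rw [Prod.mk.injEq] at h2
    obtain rfl := Subtype.ext h2.1
    simp [agree, h2.2]
  · intro h
    refine Subtype.ext ?_
    simp only [target, Finset.map_eq_image]
    refine Finset.image_congr fun v hv => ?_
    obtain ⟨w, hw, rfl⟩ := Finset.mem_map.1 (Finset.mem_coe.1 hv)
    have := h hw
    simp only [agree, Finset.mem_filter] at this
    rw [Function.Embedding.subtype_apply, copy_apply_coe, copy_apply_coe, this.2]

open Classical in
/-- The strategy: in the blocks of star edges reply with the center; in the block of another edge,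
complete this edge of a copy whose star has been built, if there is one. Blocks and rounds are
numbered from the last one. -/
def respond (t : ℕ) (us : List (Subsets n r)) (u : Subsets n r) : Subsets n (s - r) :=
  -- Counted from the last of the `e * t` rounds, the current one has index `e * t - 1 - us.length`;
  -- `us` is the full sequence without its first `e * t - us.length` entries, hence the shift in the
  -- lookup below.
  if h : (e * t - 1 - us.length) / t < e then
    if hx : (⟨_, h⟩ : Fin e) ∉ p.star ∧ ∃ x, p.target ι x ⟨_, h⟩ = u ∧ ∀ i ∈ p.star, ∃ b, b < t ∧
        us[i.1 * t + b - (e * t - us.length)]? = some (p.target ι x i)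
    then p.reply ι hx.2.choose ⟨_, h⟩
    -- In a star block every tuple gives the center, so the tuple `0` serves; elsewhere it is a mere
    -- default.
    else p.reply ι 0 ⟨_, h⟩
  else Classical.arbitrary _

/-- The sequence of rounds, the most recent one first, given by its blocks. -/
def flatten {α : Type*} (ω : Fin e → Fin t → α) : Fin (e * t) → α :=
  fun j => ω (finProdFinEquiv.symm j).1 (finProdFinEquiv.symm j).2

theorem flatten_getElem? {α : Type*} (ω : Fin e → Fin t → α) (i : Fin e) (b : Fin t) :
    (List.ofFn (flatten ω))[i.1 * t + b.1]? = some (ω i b) := by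
  have h : i.1 * t + b.1 = (finProdFinEquiv (i, b)).1 := by
    simp [finProdFinEquiv, add_comm, mul_comm]
  rw [h, List.getElem?_ofFn, dif_pos (finProdFinEquiv (i, b)).2]
  simp only [flatten, Fin.eta, Equiv.symm_apply_apply]

/-- For an extra edge, any tuple the player may pick has the same target as `x`, hence agrees with
`x` on the `r` elements of `R i`, and its star has been hit. Isolation leaves only `x`. -/
theorem respond_eq (ω : Fin e → Fin t → Subsets n r) (x : {v // v ∉ p.C} → Fin N)
    (hx : IsIsolatedHit (p.target ι) p.star r ω x) (i : Fin e) (b : Fin t) :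
    p.respond ι t ((List.ofFn (flatten ω)).drop (i.1 * t + b.1 + 1)) (p.target ι x i) =
      p.reply ι x i := by
  have ht : 0 < t := b.pos
  have hlt : i.1 * t + b.1 + 1 ≤ e * t := by
    calc i.1 * t + b.1 + 1 ≤ i.1 * t + t := by have := b.2; omega
      _ = (i.1 + 1) * t := by ring
      _ ≤ e * t := Nat.mul_le_mul_right t i.2
  have hlen : ((List.ofFn (flatten ω)).drop (i.1 * t + b.1 + 1)).length =
      e * t - (i.1 * t + b.1 + 1) := by simp
  have hdiv : (e * t - 1 - (e * t - (i.1 * t + b.1 + 1))) / t = i.1 := by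
    have : e * t - 1 - (e * t - (i.1 * t + b.1 + 1)) = b.1 + i.1 * t := by omega
    rw [this, Nat.add_mul_div_right _ _ ht, Nat.div_eq_of_lt b.2, zero_add]
  have hi : (⟨(e * t - 1 - (e * t - (i.1 * t + b.1 + 1))) / t, by rw [hdiv]; exact i.2⟩ : Fin e)
      = i := Fin.ext hdiv
  unfold respond
  simp only [hlen, hi]
  rw [dif_pos (by rw [hdiv]; exact i.2)]
  have hsub : e * t - (e * t - (i.1 * t + b.1 + 1)) = i.1 * t + b.1 + 1 := by omega
  simp only [hsub, List.getElem?_drop]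
  by_cases his : i ∈ p.star
  · rw [dif_neg (fun h => h.1 his)]
    exact p.reply_eq_of_mem_star ι 0 x his
  -- Star blocks have larger indices, that is, they were played earlier; thus the subtraction is not
  -- truncated.
  · have hidx : ∀ i' ∈ p.star, ∀ b', i.1 * t + b.1 + 1 + (i'.1 * t + b' - (i.1 * t + b.1 + 1)) =
        i'.1 * t + b' := by
      intro i' hi' b'
      have h1 : i.1 + 1 ≤ i'.1 := p.lt_star i his i' hi'
      have h2 := Nat.mul_le_mul_right t h1
      have h3 := b.2
      rw [add_mul] at h2
      omega
    have hex : i ∉ p.star ∧ ∃ y, p.target ι y i = p.target ι x i ∧ ∀ i' ∈ p.star, ∃ b', b' < t ∧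
        (List.ofFn (flatten ω))[i.1 * t + b.1 + 1 + (i'.1 * t + b' - (i.1 * t + b.1 + 1))]? =
          some (p.target ι y i') := by
      refine ⟨his, x, rfl, fun i' hi' => ?_⟩
      obtain ⟨b', hb'⟩ := mem_hitting.1 (hx.1 i')
      exact ⟨b', b'.2, by rw [hidx i' hi', flatten_getElem?, hb']⟩
    rw [dif_pos hex]
    obtain ⟨hy1, hy2⟩ := hex.2.choose_spec
    congr 1
    by_contra hne
    refine hx.2 _ hne fun i' hi' => ?_
    have hr : r ≤ (agree x hex.2.choose).card := by
      refine (p.card_R i).symm.le.trans ?_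
      exact Finset.card_le_card ((p.target_eq_iff ι _ _ i).1 hy1.symm)
    rw [forbidden, if_pos hr] at hi'
    obtain ⟨b', hb't, hb'⟩ := hy2 i' hi'
    rw [hidx i' hi', flatten_getElem? ω i' ⟨b', hb't⟩] at hb'
    exact mem_hitting.2 ⟨⟨b', hb't⟩, Option.some.inj hb'⟩

theorem containsCopy_of_isIsolatedHit (ω : Fin e → Fin t → Subsets n r)
    (x : {v // v ∉ p.C} → Fin N) (hx : IsIsolatedHit (p.target ι) p.star r ω x) :
    hypergraph (play (p.respond ι t) (List.ofFn (flatten ω))) ∈ containsCopy G n := by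
  refine ⟨p.copy ι x, fun f hf => ?_⟩
  obtain ⟨i, rfl⟩ := p.mem_edges f hf
  obtain ⟨b, hb⟩ := mem_hitting.1 (hx.1 i)
  have hj := flatten_getElem? ω i b
  obtain ⟨hjl, hj⟩ := List.getElem?_eq_some_iff.1 hj
  have hm := mem_play (p.respond ι t) _ _ hjl
  rw [hj, hb, p.respond_eq ι ω x hx i b] at hm
  exact mem_hypergraph.2 ⟨_, hm, p.target_val_add_reply_val ι x i⟩

/-- The expected number of tuples with all targets hit, less the share that fails to be isolated. -/
theorem prob_respond_ge (hN : 1 ≤ N) (η : ℝ) (hη : 0 ≤ η)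
    (hq : ∀ J : Finset {v // v ∉ p.C}, J ≠ Finset.univ →
      hitProb (Fintype.card (Subsets n r)) t ^
        ((forbidden p.star r J).filter fun i => ¬ p.R i ⊆ J).card ≤
        η * ((N : ℝ) ^ (Fintype.card {v // v ∉ p.C} - J.card))⁻¹) :
    ENNReal.ofReal ((N : ℝ) ^ Fintype.card {v // v ∉ p.C} *
      hitProb (Fintype.card (Subsets n r)) t ^ e *
        (1 - 2 ^ Fintype.card {v // v ∉ p.C} * η)) ≤
      prob (detStrategy (p.respond ι t)) (containsCopy G) (e * t) := by
  classical
  let A : Finset (Fin e → Fin t → Subsets n r) :=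
    Finset.univ.filter fun ω => ∃ x, IsIsolatedHit (p.target ι) p.star r ω x
  have h1 := card_exists_isIsolatedHit_ge (t := t) (p.target ι) p.R (p.target_eq_iff ι) p.star r
    hN η hη hq A (by simp [A])
  have hinj : Function.Injective (flatten : (Fin e → Fin t → Subsets n r) → _) := by
    intro ω ω' h
    funext i b
    have := congrFun h (finProdFinEquiv (i, b))
    simpa [flatten] using this
  have h2 := prob_detStrategy (p.respond ι t) (containsCopy G) (e * t) (A.image flatten) (by
    intro ω hω
    obtain ⟨ω, hω', rfl⟩ := Finset.mem_image.1 hω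
    obtain ⟨x, hx⟩ := (Finset.mem_filter.1 hω').2
    exact p.containsCopy_of_isIsolatedHit ι ω x hx)
  rw [Finset.card_image_of_injective _ hinj] at h2
  refine le_trans ?_ h2
  have hM : (0 : ℝ) < Fintype.card (Subsets n r) := by exact_mod_cast Fintype.card_pos
  rw [mul_comm t e, ← le_div_iff₀' (by positivity)] at h1
  refine (ENNReal.ofReal_le_ofReal h1).trans (le_of_eq ?_)
  rw [ENNReal.ofReal_div_of_pos (by positivity), ENNReal.ofReal_natCast, ENNReal.ofReal_pow hM.le,
    ENNReal.ofReal_natCast, ENNReal.div_eq_inv_mul]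

end BuildingPlan
end SemiRandom
end

/-! ### Constant success probability at the predicted time -/

noncomputable section
namespace SemiRandom

/-- Compare `e`-th powers: `h` makes `q` at most `η * N ^ (-m / e)`, and `haj` says that `a` such
factors beat `N ^ (m - j)` tuples. -/
theorem pow_le_mul_inv_pow {q η : ℝ} {N e m j a : ℕ} (hq : 0 ≤ q) (hη : 0 ≤ η) (hη1 : η ≤ 1)
    (hN : 1 ≤ N) (he : e ≠ 0) (ha : 1 ≤ a) (h : q ^ e * (N : ℝ) ^ m ≤ η ^ e)
    (haj : e * (m - j) ≤ m * a) : q ^ a ≤ η * ((N : ℝ) ^ (m - j))⁻¹ := by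
  have hN0 : (0 : ℝ) < N := by exact_mod_cast hN
  refine le_of_pow_le_pow_left₀ he (by positivity) ?_
  have h1 : (q ^ e * (N : ℝ) ^ m) ^ a ≤ η ^ e := by
    refine (pow_le_pow_left₀ (by positivity) h a).trans ?_
    exact pow_le_of_le_one (by positivity) (pow_le_one₀ hη hη1) (by omega)
  rw [mul_pow, inv_pow, ← pow_mul, ← pow_mul, ← div_eq_mul_inv, le_div_iff₀ (by positivity)]
  calc q ^ (a * e) * (N : ℝ) ^ ((m - j) * e) ≤ q ^ (a * e) * (N : ℝ) ^ (m * a) := by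
        refine mul_le_mul_of_nonneg_left (pow_le_pow_right₀ (by exact_mod_cast hN) ?_)
          (by positivity)
        rw [mul_comm]
        exact haj
    _ = (q ^ e * (N : ℝ) ^ m) ^ a := by
        rw [mul_pow, ← pow_mul, ← pow_mul, mul_comm a e]
    _ ≤ _ := h1

/-- This makes κ nonnegative, as `e` is at least the number of star edges. -/
theorem le_mul_choose {m r : ℕ} (hr : 1 ≤ r) (hrm : r ≤ m) : m ≤ r * m.choose r := by
  obtain ⟨r, rfl⟩ : ∃ r', r = r' + 1 := ⟨r - 1, by omega⟩
  obtain ⟨d, rfl⟩ : ∃ d, m = r + 1 + d := ⟨m - (r + 1), by omega⟩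
  have h := Nat.choose_add_mul_choose_le (r + 1) d r
  have h2 : (r + 1).choose r = r + 1 := Nat.choose_succ_self_right r
  rw [Nat.choose_self, h2] at h
  calc r + 1 + d ≤ (r + 1) * (1 + d * (r + 1)) := by
        nlinarith [Nat.zero_le (d * r), Nat.zero_le (d * r * r)]
    _ ≤ _ := Nat.mul_le_mul_left (r + 1) h

namespace BuildingPlan

variable {V : Type*} [Fintype V] [DecidableEq V] {r s e : ℕ} {G : UniformHypergraph V s}
  (p : BuildingPlan G r e)

/-- If `J` has at least `r` elements, at most C(|J|,r) star targets lie inside it because `R` is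
injective on the star, and convexity applies. Otherwise no `R i` fits into `J` and all `e` blocks
count. -/
theorem card_new_targets {m : ℕ} (hm : Fintype.card {v // v ∉ p.C} = m) (hr : 1 ≤ r)
    (he : 0 < e) (h : e * (m - r) + m ≤ m * m.choose r) (J : Finset {v // v ∉ p.C})
    (hJ : J ≠ Finset.univ) :
    1 ≤ ((forbidden p.star r J).filter fun i => ¬ p.R i ⊆ J).card ∧
      e * (m - J.card) ≤ m * ((forbidden p.star r J).filter fun i => ¬ p.R i ⊆ J).card := by
  have hJm : J.card < m := by
    rw [← hm, ← Finset.card_univ]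
    exact Finset.card_lt_card (Finset.ssubset_univ_iff.2 hJ)
  have key : e * (m - J.card) ≤
      m * ((forbidden p.star r J).filter fun i => ¬ p.R i ⊆ J).card := by
    by_cases hrJ : r ≤ J.card
    · rw [forbidden, if_pos hrJ]
      have h1 := Nat.mul_sub_choose_le hr h J.card hrJ hJm
      have h2 : (p.star.filter fun i => p.R i ⊆ J).card ≤ J.card.choose r := by
        rw [← Finset.card_powersetCard]
        refine Finset.card_le_card_of_injOn p.R ?_ ?_
        · intro i hi
          exact Finset.mem_powersetCard.2 ⟨(Finset.mem_filter.1 hi).2, p.card_R i⟩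
        · exact p.R_injOn.mono fun i hi => (Finset.mem_filter.1 hi).1
      have h3 := Finset.card_filter_add_card_filter_not (s := p.star) (fun i => p.R i ⊆ J)
      rw [p.card_star] at h3
      have h4 : Fintype.card V - p.C.card = m := by
        rw [← hm, Fintype.card_subtype_compl, Fintype.card_coe]
      rw [h4] at h3
      rw [← h3, mul_add] at h1
      have h5 := Nat.mul_le_mul_left m h2
      omega
    · rw [forbidden, if_neg hrJ, Finset.filter_true_of_mem, Finset.card_univ, Fintype.card_fin,
        mul_comm m e]
      · exact Nat.mul_le_mul_left e (Nat.sub_le _ _)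
      · intro i _ hi
        have := Finset.card_le_card hi
        rw [p.card_R] at this
        exact hrJ this
  refine ⟨?_, key⟩
  by_contra h0
  have h0' : ((forbidden p.star r J).filter fun i => ¬ p.R i ⊆ J).card = 0 := by omega
  rw [h0', mul_zero, nonpos_iff_eq_zero, mul_eq_zero] at key
  omega

/-- The strategy of a building plan succeeds with probability bounded below within the predicted
number of rounds. -/
theorem exists_strategy_prob_ge {m : ℕ} (hm : Fintype.card {v // v ∉ p.C} = m) (hr : 1 ≤ r)
    (hrm : r ≤ m) (he : 0 < e) (h : e * (m - r) + m ≤ m * m.choose r) (hme : m ≤ r * e)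
    (hV : 0 < Fintype.card V) :
    ∃ c : ℝ, 0 < c ∧ ∀ᶠ n : ℕ in atTop, ∃ S : Strategy r s n,
      ENNReal.ofReal c ≤
        prob S (containsCopy G) (e * ⌈(n : ℝ) ^ ((r : ℝ) - (m : ℝ) / e)⌉₊) := by
  set κ : ℝ := (r : ℝ) - (m : ℝ) / e with hκ
  set K : ℝ := 2 ^ r * r.factorial with hK
  have hK0 : 0 < K := by positivity
  have heR : (0 : ℝ) < e := by exact_mod_cast he
  -- With this `η` the loss from non-isolated tuples is exactly `2 ^ m * η = 1 / 2`.
  set η : ℝ := ((2 : ℝ) ^ (m + 1))⁻¹ with hη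
  have hη0 : 0 < η := by positivity
  have hη1 : η ≤ 1 := inv_le_one_of_one_le₀ (one_le_pow₀ (by norm_num))
  have hVR : (0 : ℝ) < Fintype.card V := by exact_mod_cast hV
  -- The first bound lets the classes, of size `⌊δ * n⌋₊`, fit into `Fin n`; the second gives `q ^ e
  -- * N ^ m ≤ η ^ e`.
  set δ : ℝ := min ((Fintype.card V : ℝ)⁻¹) (η ^ e / (2 * K) ^ e) with hδ
  have hδ0 : 0 < δ := lt_min (by positivity) (by positivity)
  have hδV : δ ≤ (Fintype.card V : ℝ)⁻¹ := min_le_left _ _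
  have hδ1 : δ ≤ 1 := hδV.trans (inv_le_one_of_one_le₀ (by exact_mod_cast hV))
  have hκ0 : 0 ≤ κ := by
    rw [hκ, sub_nonneg, div_le_iff₀ heR]
    exact_mod_cast hme
  have hκr : κ ≤ r := by
    rw [hκ, sub_le_self_iff]
    positivity
  -- This is `N ^ m * q ^ e / 2` with the bounds `δ / 2 * n ≤ N` and `(1 + 2 * K)⁻¹ * (x / n ^ r) ≤
  -- q` inserted; the powers of `n` cancel.
  refine ⟨(δ / 2) ^ m * ((1 + 2 * K)⁻¹) ^ e * (1 / 2), by positivity, ?_⟩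
  filter_upwards [eventually_ge_atTop (2 * r), eventually_ge_atTop 1,
    eventually_ge_atTop ⌈2 / δ⌉₊] with n hn hn1 hnδ
  have hn0 : (0 : ℝ) < n := by exact_mod_cast hn1
  have hn1' : (1 : ℝ) ≤ n := by exact_mod_cast hn1
  set x : ℝ := (n : ℝ) ^ κ with hx
  have hx1 : 1 ≤ x := Real.one_le_rpow hn1' hκ0
  have hxr : x ≤ (n : ℝ) ^ r := by
    rw [hx, ← Real.rpow_natCast]
    exact Real.rpow_le_rpow_of_exponent_le hn1' hκr
  -- The defining property of κ: `N ^ m * q ^ e` is of constant order.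
  have hxe : x ^ e * (n : ℝ) ^ m = ((n : ℝ) ^ r) ^ e := by
    rw [hx, ← Real.rpow_natCast, ← Real.rpow_mul hn0.le, ← Real.rpow_natCast,
      ← Real.rpow_add hn0, ← pow_mul, ← Real.rpow_natCast]
    congr 1
    rw [hκ, sub_mul, div_mul_cancel₀ _ heR.ne']
    push_cast
    ring
  set t := ⌈x⌉₊ with ht
  have hxt : x ≤ t := Nat.le_ceil x
  have htx : (t : ℝ) ≤ 2 * x := by
    have := Nat.ceil_lt_add_one (zero_le_one.trans hx1)
    rw [← ht] at this
    linarith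
  have hMcard := card_subsets n r (by omega)
  set M := Fintype.card (Subsets n r) with hM
  have hM1 : 1 ≤ M := Fintype.card_pos
  have hM0 : (0 : ℝ) < M := by exact_mod_cast hM1
  have hnM : (n : ℝ) ^ r ≤ K * M := by
    rw [hMcard]
    exact pow_le_mul_choose hn
  have hMn : (M : ℝ) ≤ (n : ℝ) ^ r := by
    rw [hMcard]
    exact_mod_cast Nat.choose_le_pow n r
  have hnr : (0 : ℝ) < (n : ℝ) ^ r := by positivity
  have hp_le : (t : ℝ) / M ≤ 2 * K * (x / (n : ℝ) ^ r) := by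
    rw [div_le_iff₀ hM0]
    calc (t : ℝ) ≤ 2 * x := htx
      _ = 2 * (x / (n : ℝ) ^ r) * (n : ℝ) ^ r := by field_simp
      _ ≤ 2 * (x / (n : ℝ) ^ r) * (K * M) := by gcongr
      _ = _ := by ring
  have hp_ge : x / (n : ℝ) ^ r ≤ (t : ℝ) / M := by gcongr
  have hp_le' : (t : ℝ) / M ≤ 2 * K := by
    refine hp_le.trans ?_
    have : x / (n : ℝ) ^ r ≤ 1 := (div_le_one hnr).2 hxr
    exact mul_le_of_le_one_right (by positivity) this
  set q := hitProb M t with hq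
  have hq0 : 0 ≤ q := hitProb_nonneg hM1 t
  have hqle : q ≤ 2 * K * (x / (n : ℝ) ^ r) := (hitProb_le hM1 t).trans hp_le
  have hqge : (1 + 2 * K)⁻¹ * (x / (n : ℝ) ^ r) ≤ q := by
    refine le_trans ?_ (div_one_add_le_hitProb hM1 t)
    rw [mul_comm, ← div_eq_mul_inv]
    gcongr
  have hxe' : (x / (n : ℝ) ^ r) ^ e * (n : ℝ) ^ m = 1 := by
    rw [div_pow, div_mul_eq_mul_div, hxe, div_self (by positivity)]
  set N := ⌊δ * n⌋₊ with hN
  have hNle : (N : ℝ) ≤ δ * n := Nat.floor_le (by positivity)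
  have hδn : 2 ≤ δ * n := by
    have := Nat.le_of_ceil_le hnδ
    rw [div_le_iff₀ hδ0] at this
    linarith
  have hNge : δ / 2 * n ≤ N := by
    have := Nat.lt_floor_add_one (δ * n)
    rw [← hN] at this
    linarith
  have hN1 : 1 ≤ N := Nat.le_floor (by push_cast; linarith)
  have hm1 : m ≠ 0 := by omega
  have hqN : q ^ e * (N : ℝ) ^ m ≤ η ^ e := by
    calc q ^ e * (N : ℝ) ^ m ≤ (2 * K * (x / (n : ℝ) ^ r)) ^ e * (δ * n) ^ m := by gcongr
      _ = (2 * K) ^ e * δ ^ m * ((x / (n : ℝ) ^ r) ^ e * (n : ℝ) ^ m) := by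
          rw [mul_pow, mul_pow]; ring
      _ = (2 * K) ^ e * δ ^ m := by rw [hxe', mul_one]
      _ ≤ (2 * K) ^ e * δ := by
          gcongr
          exact pow_le_of_le_one hδ0.le hδ1 hm1
      _ ≤ (2 * K) ^ e * (η ^ e / (2 * K) ^ e) := by
          gcongr
          exact min_le_right _ _
      _ = η ^ e := by field_simp
  have hcard : Fintype.card (V × Fin N) ≤ Fintype.card (Fin n) := by
    rw [Fintype.card_prod, Fintype.card_fin, Fintype.card_fin]
    have : (Fintype.card V : ℝ) * N ≤ n := by
      calc (Fintype.card V : ℝ) * N ≤ Fintype.card V * ((Fintype.card V : ℝ)⁻¹ * n) := by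
            gcongr
            exact hNle.trans (by gcongr)
        _ = n := by field_simp
    exact_mod_cast this
  obtain ⟨ι⟩ := Function.Embedding.nonempty_of_card_le hcard
  have : NeZero N := ⟨by omega⟩
  refine ⟨detStrategy (p.respond ι t), le_trans (ENNReal.ofReal_le_ofReal ?_)
    (p.prob_respond_ge ι hN1 η hη0.le ?_)⟩
  · rw [hm, ← hM, ← hq]
    have h1 : 1 - 2 ^ m * η = 1 / 2 := by
      rw [hη, pow_succ]
      field_simp
      norm_num
    rw [h1]
    refine mul_le_mul_of_nonneg_right ?_ (by norm_num)
    calc (δ / 2) ^ m * ((1 + 2 * K)⁻¹) ^ e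
        = (δ / 2 * n) ^ m * ((1 + 2 * K)⁻¹ * (x / (n : ℝ) ^ r)) ^ e := by
          rw [mul_pow, mul_pow _ (x / (n : ℝ) ^ r)]
          linear_combination (-(δ / 2) ^ m * ((1 + 2 * K)⁻¹) ^ e) * hxe'
      _ ≤ (N : ℝ) ^ m * q ^ e := by gcongr
  · intro J hJ
    obtain ⟨ha, haj⟩ := p.card_new_targets hm hr he h J hJ
    rw [hm]
    exact pow_le_mul_inv_pow hq0 hη0.le hη1 hN1 he.ne' ha hqN haj

end BuildingPlan

end SemiRandom
end

/-! ### From constant probability to the threshold exponent -/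

noncomputable section
namespace SemiRandom

variable {r s : ℕ}

theorem prob_le_one {n : ℕ} (S : Strategy r s n) (P : HypergraphProperty) (t : ℕ) :
    prob S P t ≤ 1 :=
  (prob_add_compl S P t) ▸ le_self_add

/-- Strategies that succeed with probability bounded below can be repeated to succeed with
probability arbitrarily close to `1`. -/
theorem exists_strategies_of_prob_ge (P : HypergraphProperty)
    (hP : ∀ (n : ℕ) (H H' : MultiHypergraph n), H ≤ H' → H ∈ P n → H' ∈ P n) (T : ℕ → ℕ)
    (c : ℝ) (hc : 0 < c)
    (h : ∀ᶠ n : ℕ in atTop, ∃ S : Strategy r s n, ENNReal.ofReal c ≤ prob S P (T n)) :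
    ∃ S : (n : ℕ) → Strategy r s n, ∀ q : ℝ, q < 1 → ∃ K : ℕ, ∀ᶠ n : ℕ in atTop,
      ENNReal.ofReal q ≤ prob (S n) P (K * T n) := by
  classical
  -- Restarting forever makes the strategy independent of `q`; only the number `K` of runs depends
  -- on it.
  let S : (n : ℕ) → Strategy r s n := fun n =>
    if h : ∃ S : Strategy r s n, ENNReal.ofReal c ≤ prob S P (T n) then
      repeatStrategy h.choose (T n)
    else fun _ _ => PMF.pure (Classical.arbitrary _)
  refine ⟨S, fun q hq => ?_⟩
  set c' := min c 1
  have hc' : 0 < c' := lt_min hc one_pos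
  have hc1 : c' ≤ 1 := min_le_right _ _
  obtain ⟨K, hK⟩ := exists_pow_lt_of_lt_one (sub_pos.2 hq) (by linarith : 1 - c' < 1)
  refine ⟨K, h.mono fun n hn => ?_⟩
  have hS : S n = repeatStrategy hn.choose (T n) := dif_pos hn
  rw [hS]
  refine le_trans ?_ (prob_repeatStrategy_ge hn.choose P (hP n) (T n) (ENNReal.ofReal c')
    ((ENNReal.ofReal_le_ofReal (min_le_left _ _)).trans hn.choose_spec) K)
  rw [← ENNReal.ofReal_one, ← ENNReal.ofReal_sub _ hc'.le, ← ENNReal.ofReal_pow (by linarith),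
    ← ENNReal.ofReal_sub _ (by positivity)]
  exact ENNReal.ofReal_le_ofReal (by linarith)

/-- For each `q` the `K` runs take at most `K * D * n ^ κ` rounds, and `ω` eventually exceeds `K *
D`. -/
theorem tendsto_prob_of_strategies (P : HypergraphProperty)
    (hP : ∀ (n : ℕ) (H H' : MultiHypergraph n), H ≤ H' → H ∈ P n → H' ∈ P n) (T : ℕ → ℕ)
    (κ D : ℝ) (hT : ∀ᶠ n : ℕ in atTop, (T n : ℝ) ≤ D * (n : ℝ) ^ κ)
    (S : (n : ℕ) → Strategy r s n)
    (hS : ∀ q : ℝ, q < 1 → ∃ K : ℕ, ∀ᶠ n : ℕ in atTop,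
      ENNReal.ofReal q ≤ prob (S n) P (K * T n))
    (ω : ℕ → ℝ) (hω : Tendsto ω atTop atTop) :
    Tendsto (fun n : ℕ => prob (S n) P ⌊(n : ℝ) ^ κ * ω n⌋₊) atTop (𝓝 1) := by
  refine tendsto_order.2 ⟨fun a ha => ?_, fun a ha =>
    Eventually.of_forall fun n => (prob_le_one _ _ _).trans_lt ha⟩
  obtain ⟨b, hab, hb⟩ := exists_between ha
  have hbt : b ≠ ⊤ := ne_top_of_lt hb
  have hb1 : b.toReal < 1 := by
    rw [← ENNReal.toReal_one]
    exact (ENNReal.toReal_lt_toReal hbt ENNReal.one_ne_top).2 hb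
  obtain ⟨K, hK⟩ := hS b.toReal hb1
  filter_upwards [hK, hT, hω.eventually_ge_atTop (K * D)] with n h1 h2 h3
  rw [ENNReal.ofReal_toReal hbt] at h1
  refine hab.trans_le (h1.trans (prob_mono (S n) P (hP n) (Nat.le_floor ?_)))
  push_cast
  calc (K : ℝ) * T n ≤ K * (D * (n : ℝ) ^ κ) := by gcongr
    _ = (n : ℝ) ^ κ * (K * D) := by ring
    _ ≤ (n : ℝ) ^ κ * ω n := by gcongr

theorem tendsto_log_mul_rpow_div_log (c κ : ℝ) (hc : 0 < c) :
    Tendsto (fun n : ℕ => ENNReal.log (ENNReal.ofReal (c * (n : ℝ) ^ κ)) /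
      ((Real.log (n : ℝ) : ℝ) : EReal)) atTop (𝓝 (κ : EReal)) := by
  have hlog : Tendsto (fun n : ℕ => Real.log (n : ℝ)) atTop atTop :=
    Real.tendsto_log_atTop.comp tendsto_natCast_atTop_atTop
  have h1 : Tendsto (fun n : ℕ => Real.log c / Real.log (n : ℝ) + κ) atTop (𝓝 (0 + κ)) :=
    (hlog.const_div_atTop _).add tendsto_const_nhds
  rw [zero_add] at h1
  refine ((continuous_coe_real_ereal.tendsto κ).comp h1).congr' ?_
  filter_upwards [eventually_gt_atTop 1] with n hn
  have hn0 : (0 : ℝ) < n := by exact_mod_cast (by omega : 0 < n)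
  have hl : 0 < Real.log (n : ℝ) := Real.log_pos (by exact_mod_cast hn)
  have hx : 0 < (n : ℝ) ^ κ := Real.rpow_pos_of_pos hn0 κ
  rw [ENNReal.log_ofReal_of_pos (by positivity), ← EReal.coe_div, Function.comp_apply,
    Real.log_mul hc.ne' hx.ne', Real.log_rpow hn0]
  congr 1
  field_simp

/-- The optimal time lies between two constant multiples of `n ^ κ`, and the constants vanish after
division by `log n`. -/
theorem exponentAt_eq (P : HypergraphProperty) (q κ c C : ℝ) (hc : 0 < c) (hC : 0 < C)
    (hlow : ∀ᶠ n : ℕ in atTop, ∀ (S : Strategy r s n) (t : ℕ),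
      ENNReal.ofReal q ≤ prob S P t → c * (n : ℝ) ^ κ ≤ t)
    (hup : ∀ᶠ n : ℕ in atTop, ∃ (S : Strategy r s n) (t : ℕ),
      ENNReal.ofReal q ≤ prob S P t ∧ (t : ℝ) ≤ C * (n : ℝ) ^ κ) :
    exponentAt r s P q = κ := by
  have hlog : ∀ n : ℕ, (0 : EReal) ≤ ((Real.log (n : ℝ) : ℝ) : EReal) := fun n =>
    EReal.coe_nonneg.2 (Real.log_natCast_nonneg n)
  refine Tendsto.limsup_eq (tendsto_of_tendsto_of_tendsto_of_le_of_le'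
    (tendsto_log_mul_rpow_div_log c κ hc) (tendsto_log_mul_rpow_div_log C κ hC) ?_ ?_)
  · filter_upwards [hlow] with n hn
    refine EReal.div_le_div_right_of_nonneg (hlog n) (ENNReal.log_monotone ?_)
    have h1 : ((⌈c * (n : ℝ) ^ κ⌉₊ : ℕ) : ℕ∞) ≤ optimalTime r s P q n :=
      le_iInf fun S => le_iInf fun t => le_iInf fun h => by
        exact_mod_cast Nat.ceil_le.2 (hn S t h)
    refine le_trans ?_ (ENat.toENNReal_mono h1)
    rw [ENat.toENNReal_coe, ← ENNReal.ofReal_natCast]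
    exact ENNReal.ofReal_le_ofReal (Nat.le_ceil _)
  · filter_upwards [hup] with n hn
    obtain ⟨S, t, h, ht⟩ := hn
    refine EReal.div_le_div_right_of_nonneg (hlog n) (ENNReal.log_monotone ?_)
    have h1 : optimalTime r s P q n ≤ (t : ℕ∞) :=
      (iInf_le _ S).trans ((iInf_le _ t).trans (iInf_le _ h))
    refine (ENat.toENNReal_mono h1).trans ?_
    rw [ENat.toENNReal_coe, ← ENNReal.ofReal_natCast]
    exact ENNReal.ofReal_le_ofReal ht

end SemiRandom
end

theorem mainTheorem8 {V : Type*} [Fintype V] [DecidableEq V] (r s k l : ℕ)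
    (hr : 2 ≤ r) (hs : r < s) (hk : Fintype.card V = k)
    (G : UniformHypergraph V s) (hG : G.IsStarplus (s - r) l)
    (hl : (l : ℝ) ≤
      ((r : ℝ) * ((k - s + r).choose r : ℝ) - ((k : ℝ) - (s : ℝ) + (r : ℝ))) /
        ((k : ℝ) - (s : ℝ)))
    (κ : ℝ)
    (hκ : κ = (r : ℝ) -
      ((k : ℝ) - (s : ℝ) + (r : ℝ)) / (((k - s + r).choose r : ℝ) + (l : ℝ))) :
    (∃ S : (n : ℕ) → SemiRandom.Strategy r s n,
      ∀ ω : ℕ → ℝ, Tendsto ω atTop atTop →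
        Tendsto
          (fun n : ℕ =>
            SemiRandom.prob (S n) (SemiRandom.containsCopy G) ⌊(n : ℝ) ^ κ * ω n⌋₊)
          atTop (𝓝 1)) ∧
    SemiRandom.HasThresholdExponent r s (SemiRandom.containsCopy G) (κ : EReal) := by
  have hsk : s ≤ k := hk ▸ hG.2.2.1
  obtain ⟨hcard, ⟨p⟩⟩ := SemiRandom.exists_buildingPlan hs G hG
  rw [hk] at hcard
  set e := G.edges.card with he
  set m := k - s + r with hm
  have hrm : r ≤ m := Nat.le_add_left _ _
  have hB : 0 < m.choose r := Nat.choose_pos hrm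
  have he0 : 0 < e := by omega
  have heR : (0 : ℝ) < e := by exact_mod_cast he0
  have hmR : (m : ℝ) = (k : ℝ) - s + r := by
    rw [hm]
    push_cast [Nat.cast_sub hsk]
    ring
  have heR' : (e : ℝ) = (m.choose r : ℝ) + l := by
    rw [hcard]
    push_cast
    ring
  have hκ' : κ = (r : ℝ) - (m : ℝ) / e := by rw [hκ, hmR, heR']
  have hW : Fintype.card {v // v ∉ p.C} = m := by
    rw [Fintype.card_subtype_compl, Fintype.card_coe, p.card_C, hk]
    omega
  -- This is `hl` without denominators. For `k = s` the quotient in `hl` has denominator zero, but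
  -- then `m = r` and both sides equal `m`.
  have hexcess : e * (m - r) + m ≤ m * m.choose r := by
    rcases hsk.eq_or_lt with rfl | hlt
    · have : m = r := by omega
      simp [this]
    · have hks : (0 : ℝ) < (k : ℝ) - s := sub_pos.2 (by exact_mod_cast hlt)
      rw [le_div_iff₀ hks] at hl
      have h1 : ((e * (m - r) + m : ℕ) : ℝ) ≤ ((m * m.choose r : ℕ) : ℝ) := by
        push_cast [Nat.cast_sub hrm]
        rw [heR', hmR]
        linarith
      exact_mod_cast h1
  have hme : m ≤ r * e :=
    (SemiRandom.le_mul_choose (by omega) hrm).trans (Nat.mul_le_mul_left r (by omega))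
  have hκ0 : 0 ≤ κ := by
    rw [hκ', sub_nonneg, div_le_iff₀ heR]
    exact_mod_cast hme
  obtain ⟨c, hc, hbase⟩ := p.exists_strategy_prob_ge hW (by omega) hrm he0 hexcess hme (by omega)
  rw [← hκ'] at hbase
  have hmono : ∀ (n : ℕ) (H H' : SemiRandom.MultiHypergraph n), H ≤ H' →
      H ∈ SemiRandom.containsCopy G n → H' ∈ SemiRandom.containsCopy G n :=
    fun n H H' => SemiRandom.containsCopy_mono G
  obtain ⟨S, hS⟩ := SemiRandom.exists_strategies_of_prob_ge _ hmono _ c hc hbase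
  have hT : ∀ᶠ n : ℕ in atTop, ((e * ⌈(n : ℝ) ^ κ⌉₊ : ℕ) : ℝ) ≤ 2 * e * (n : ℝ) ^ κ := by
    filter_upwards [eventually_ge_atTop 1] with n hn
    have hx1 : 1 ≤ (n : ℝ) ^ κ := Real.one_le_rpow (by exact_mod_cast hn) hκ0
    have := Nat.ceil_lt_add_one (zero_le_one.trans hx1)
    push_cast
    nlinarith
  refine ⟨⟨S, fun ω hω =>
    SemiRandom.tendsto_prob_of_strategies _ hmono _ κ (2 * e) hT S hS ω hω⟩, ?_⟩
  obtain ⟨c₁, hc₁, hlow⟩ := SemiRandom.exists_forall_prob_half_le (r := r) G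
    (Finset.card_pos.1 he0) hs.le (hk ▸ hsk)
  rw [hk, ← hmR, ← he, ← hκ'] at hlow
  refine tendsto_const_nhds.congr' ?_
  -- Only `q` close to 1 matters; for `q > 1 / 2` the first moment bound applies and the exponent
  -- already equals `κ`.
  filter_upwards [Ioo_mem_nhdsLT (by norm_num : (1 / 2 : ℝ) < 1)] with q hq
  obtain ⟨K, hK⟩ := hS q hq.2
  refine (SemiRandom.exponentAt_eq _ q κ c₁ ((K + 1) * (2 * e)) hc₁ (by positivity) ?_ ?_).symm
  · filter_upwards [eventually_ge_atTop (2 * r), eventually_gt_atTop 0] with n hn hn0 S t h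
    exact hlow n hn hn0 S t ((ENNReal.ofReal_le_ofReal hq.1.le).trans h)
  · filter_upwards [hK, hT] with n h1 h2
    refine ⟨S n, _, h1, ?_⟩
    rw [Nat.cast_mul]
    have h3 : (0 : ℝ) ≤ (n : ℝ) ^ κ := by positivity
    calc (K : ℝ) * ((e * ⌈(n : ℝ) ^ κ⌉₊ : ℕ) : ℝ) ≤ (K + 1) * (2 * e * (n : ℝ) ^ κ) := by
          gcongr
          linarith
      _ = _ := by ring
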